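/- **Setting.** Let $p\in(1,\infty)$, let $\Omega\subset\mathbb R^2$ be open, and let $a:\Omega\times\mathbb R^2\to\mathbb R^2$ be a Carathéodory function (measurable in $x$ for every $\xi$, continuous in $\xi$ for a.e. $x$) with $a(\cdot,0)\equiv0$. Put $$\lambda(x):=\inf_{\xi\ne0}\frac{a(x,\xi)\cdot\xi}{|\xi|^p},\qquad \mu(x):=\sup_{\xi\neq0}\frac{|a(x,\xi)|^p}{(a(x,\xi)\cdot\xi)^{p-1}},$$ and assume that $\lambda,\mu\ge0$ a.e. in $\Omega$, $\mu\in L^1(\Omega)$ and $\lambda^{-1}\in L^{1/(p-1)}(\Omega)$. Let $H^{1,p}(\Omega,a)$ and $H^{1,p}_0(\Omega,a)$ be the completions of (the functions of finite norm in) $C^1(\Omega)$ and $C^1_c(\Omega)$, respectively, with respect to the norm $$\|u\|_{H^{1,p}(\Omega,a)}=\Big(\int_\Omega\lambda|\nabla u|^p+\mu|u|^p\,dx\Big)^{1/p}.$$ A function $u\in H^{1,p}(\Omega,a)$ is called a weak subsolution of $\nabla\cdot a(x,\nabla u)=0$ in $\Omega$ if $$\int_\Omega a(x,\nabla u)\cdot\nabla\phi\,dx\le0\qquad\text{for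 all }\phi\in H^{1,p}_0(\Omega,a)\text{ with }\phi\ge0.$$ Here $\int_\Omega f\le0$ means $\int_\Omega f_+\le\int_\Omega f_-$ in $[0,\infty]$, which is the usual inequality whenever the integral exists. For a ball $B_R$ of radius $R$ in $\mathbb R^2$ and $v\in W^{1,1}(B_R)$ let $$\|v\|_{\underline W^{1,1}(B_R)}:=R^{-2}\|v\|_{L^1(B_R)}+R^{-1}\|\nabla v\|_{L^1(B_R)}.$$ **Proposition.** For every $p\in(1,\infty)$ there is a constant $c\in[1,\infty)$, depending only on $p$, such that for all $\Omega$ and $a$ as above, every weak subsolution $u$ of $\nabla\cdot a(x,\nabla u)=0$ in $\Omega$ and every open ball $B_R\subset\Omega$, one has $u_+=\max\{u,0\}\in W^{1,1}(B_R)$ and $$\sup_{B_{R/2}}u\le c\,\|u_+\|_{\underline W^{1,1}(B_R)},$$ where $B_{R/2}$ is the concentric ball of radius $R/2$ and $\sup$ denotes the essential supremum. -/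

import Mathlib

open MeasureTheory Set Filter Topology
open scoped ENNReal

namespace NonuniformElliptic

/-- The Euclidean space `ℝ^d`. -/
abbrev E (d : ℕ) := EuclideanSpace ℝ (Fin d)

variable {d : ℕ}

/-- `a` is a Caratheodory function on `Ω × ℝ^d`: measurable in `x` for every `ξ`, and continuous
in `ξ` for almost every `x ∈ Ω`. -/
def IsCaratheodory (Ω : Set (E d)) (a : E d → E d → E d) : Prop :=
  (∀ ξ : E d, AEMeasurable (fun x => a x ξ) (volume.restrict Ω)) ∧
    ∀ᵐ x ∂(volume.restrict Ω), Continuous (a x)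

/-- `λ(x) = inf_{ξ ≠ 0} a(x,ξ)·ξ / |ξ|^p`, with values in `[0,∞]`.  The value is `0` as soon as the
infimum is nonpositive, so `1/λ` (with `1/0 = ∞`) can be integrable only if `a(x,ξ)·ξ > 0` for
all `ξ ≠ 0` and almost every `x`. -/
noncomputable def lam (p : ℝ) (a : E d → E d → E d) (x : E d) : ℝ≥0∞ :=
  ⨅ (ξ : E d) (_ : ξ ≠ 0), ENNReal.ofReal (inner ℝ (a x ξ) ξ / ‖ξ‖ ^ p)

/-- `μ(x) = sup_{ξ ≠ 0} |a(x,ξ)|^p / (a(x,ξ)·ξ)^(p-1)`, with values in `[0,∞]`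
(here `s / 0 = ∞` for `s > 0`). -/
noncomputable def mu (p : ℝ) (a : E d → E d → E d) (x : E d) : ℝ≥0∞ :=
  ⨆ (ξ : E d) (_ : ξ ≠ 0), ‖a x ξ‖ₑ ^ p / ENNReal.ofReal (inner ℝ (a x ξ) ξ) ^ (p - 1)

/-- The `p`-th power of the norm of `H^{1,p}(Ω,a)` for a pair (function, gradient):
`∫_Ω λ |G|^p + μ |u|^p`. -/
noncomputable def energy (Ω : Set (E d)) (p : ℝ) (a : E d → E d → E d)
    (u : E d → ℝ) (G : E d → E d) : ℝ≥0∞ :=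
  ∫⁻ x in Ω, (lam p a x * ‖G x‖ₑ ^ p + mu p a x * ‖u x‖ₑ ^ p)

/-- The space `C^1(Ω)`. -/
def C1 (Ω : Set (E d)) : Set (E d → ℝ) := {φ | ContDiffOn ℝ 1 φ Ω}

/-- The space `C_c^1(Ω)` (functions extended by zero outside `Ω`). -/
def C1c (Ω : Set (E d)) : Set (E d → ℝ) :=
  {φ | ContDiff ℝ 1 φ ∧ HasCompactSupport φ ∧ tsupport φ ⊆ Ω}

/-- `(u, G)` belongs to the completion of the functions in `S` of finite norm with respect to the
norm of `H^{1,p}(Ω,a)`.  The completion is realised as the closure of the pairs `(φ, ∇φ)` in the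
complete space `L^p(μ dx) × L^p(λ dx; ℝ^d)`; `G` is the gradient of the element `u`. -/
def InCompletion (S : Set (E d → ℝ)) (Ω : Set (E d)) (p : ℝ) (a : E d → E d → E d)
    (u : E d → ℝ) (G : E d → E d) : Prop :=
  AEStronglyMeasurable u (volume.restrict Ω) ∧ AEStronglyMeasurable G (volume.restrict Ω) ∧
    ∃ φ : ℕ → E d → ℝ,
      (∀ n, φ n ∈ S ∧ energy Ω p a (φ n) (gradient (φ n)) < ∞) ∧
      Tendsto (fun n => energy Ω p a (fun x => φ n x - u x) (fun x => gradient (φ n) x - G x))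
        atTop (𝓝 0)

/-- `u ∈ H^{1,p}(Ω,a)` with gradient `G`. -/
def MemH (Ω : Set (E d)) (p : ℝ) (a : E d → E d → E d) (u : E d → ℝ) (G : E d → E d) : Prop :=
  InCompletion (C1 Ω) Ω p a u G

/-- `u ∈ H_0^{1,p}(Ω,a)` with gradient `G`. -/
def MemH0 (Ω : Set (E d)) (p : ℝ) (a : E d → E d → E d) (u : E d → ℝ) (G : E d → E d) : Prop :=
  InCompletion (C1c Ω) Ω p a u G

/-- `∫ f ≤ 0`, written as `∫ f⁺ ≤ ∫ f⁻` so that it also has its usual meaning if the Lebesgue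
integral of `f` is `+∞` or `-∞`.  Nothing is demanded if both parts have infinite integral. -/
def IntegralNonpos {α : Type*} [MeasurableSpace α] (ν : Measure α) (f : α → ℝ) : Prop :=
  ∫⁻ x, ENNReal.ofReal (f x) ∂ν ≤ ∫⁻ x, ENNReal.ofReal (-f x) ∂ν

/-- For integrable `f` this is the inequality for the Bochner integral. -/
theorem integralNonpos_iff {α : Type*} [MeasurableSpace α] {ν : Measure α} {f : α → ℝ}
    (hf : Integrable f ν) : IntegralNonpos ν f ↔ ∫ x, f x ∂ν ≤ 0 := by
  have h1 : ∫⁻ x, ENNReal.ofReal (f x) ∂ν ≠ ∞ := hf.lintegral_lt_top.ne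
  have h2 : ∫⁻ x, ENNReal.ofReal (-f x) ∂ν ≠ ∞ := hf.neg.lintegral_lt_top.ne
  rw [integral_eq_lintegral_pos_part_sub_lintegral_neg_part hf, sub_nonpos,
    ENNReal.toReal_le_toReal h1 h2, IntegralNonpos]

/-- `u` is a weak subsolution of `∇ · a(x,∇u) = 0` in `Ω`: `u ∈ H^{1,p}(Ω,a)` and
`∫_Ω a(x,∇u)·∇φ ≤ 0` for all `φ ∈ H_0^{1,p}(Ω,a)` with `φ ≥ 0`. -/
def IsWeakSubsolution (Ω : Set (E d)) (p : ℝ) (a : E d → E d → E d) (u : E d → ℝ) : Prop :=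
  ∃ G : E d → E d, MemH Ω p a u G ∧
    ∀ (φ : E d → ℝ) (Φ : E d → E d), MemH0 Ω p a φ Φ →
      (∀ᵐ x ∂(volume.restrict Ω), 0 ≤ φ x) →
        IntegralNonpos (volume.restrict Ω) (fun x => inner ℝ (a x (G x)) (Φ x))

/-- `V` is the weak gradient of `v` in the open set `U`. -/
def HasWeakGradient (U : Set (E d)) (v : E d → ℝ) (V : E d → E d) : Prop :=
  LocallyIntegrableOn v U volume ∧ LocallyIntegrableOn V U volume ∧
    ∀ ψ : E d → ℝ, ContDiff ℝ (⊤ : ℕ∞) ψ → HasCompactSupport ψ → tsupport ψ ⊆ U → ∀ e : E d,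
      ∫ x in U, v x * fderiv ℝ ψ x e = - ∫ x in U, inner ℝ (V x) e * ψ x

/-- `v ∈ W^{1,1}(U)` with weak gradient `V`. -/
def MemW11 (U : Set (E d)) (v : E d → ℝ) (V : E d → E d) : Prop :=
  IntegrableOn v U volume ∧ IntegrableOn V U volume ∧ HasWeakGradient U v V

/-- The scale invariant `W^{1,1}` norm on the ball of radius `r` about `z`, for a function `v`
with weak gradient `V`: `r^{-d} ‖v‖_{L^1(B_r)} + r^{1-d} ‖∇v‖_{L^1(B_r)}`. -/
noncomputable def scaledW11Norm (z : E d) (r : ℝ) (v : E d → ℝ) (V : E d → E d) : ℝ :=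
  r ^ (-(d : ℤ)) * ∫ x in Metric.ball z r, |v x| +
    r ^ (1 - (d : ℤ)) * ∫ x in Metric.ball z r, ‖V x‖

end NonuniformElliptic

/-!
The proof is the classical two-dimensional one: a maximum principle, and a circle on which the
subsolution is bounded by one-dimensional Sobolev embedding.  The constant `4` works for all `p`.

By Hölder's inequality and `λ⁻¹ ∈ L^{1/(p-1)}`, together with `λ ≤ μ` (`lam_le_mu`, a form of the
Cauchy-Schwarz inequality), convergence in `H^{1,p}(Ω,a)` implies convergence in `W^{1,1}(Ω)`.  So
the subsolution `u` is the limit of `C^1` functions `φ n` in energy, in `W^{1,1}(Ω)` and almost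
everywhere (`MemH.exists_energyApprox`).  Composing with the `C^1` approximations `softPos δ` of the
positive part, and letting first `n → ∞` and then `δ → 0`, one gets `u₊ ∈ W^{1,1}` with gradient
`1_{u > 0} G` (`W11Approx.memW11_max`).

Traces on circles are avoided by working with the approximating functions.  Fatou's lemma in polar
coordinates gives a radius `ρ ∈ (R/2, R)` such that for infinitely many `n` the `W^{1,1}` norm of
`softPos δ (φ n)` over the circle of radius `ρ`, hence its supremum there, is bounded by the scaled
`W^{1,1}` norm of `u₊` over the disc of radius `R`, up to a small error
(`exists_radius_frequently_le`, `W11Approx.exists_radius`).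

If `φ n < M` on this circle, then `η(φ n)`, cut off outside the disc, is a `C^1` function with
compact support whenever `η` is a `C^1` function vanishing on `(-∞, M]`.  With `η` nondecreasing,
and positive beyond `M`, the limit `η(u)` is an admissible test function, and the
subsolution inequality forces its gradient `η'(u) G` to vanish, since `a(x,G)·G ≥ λ |G|^p`
(`lam_mul_le`).  The Gagliardo-Nirenberg-Sobolev inequality then shows that `η(u) = 0`, that is
`u ≤ M`, in the disc (`EnergyApprox.ae_le_of_sphere`).
-/

namespace NonuniformElliptic

variable {d : ℕ}

/-! ### A continuously differentiable positive part -/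

/-- The `C^1` approximation `√(t₊² + δ²) - δ` of the positive part `t₊`. -/
noncomputable def softPos (δ t : ℝ) : ℝ := √(max t 0 ^ 2 + δ ^ 2) - δ

/-- The derivative `t₊ / √(t₊² + δ²)` of `softPos δ`. -/
noncomputable def softPosDeriv (δ t : ℝ) : ℝ := max t 0 / √(max t 0 ^ 2 + δ ^ 2)

theorem hasDerivAt_max_zero_sq (t : ℝ) :
    HasDerivAt (fun s : ℝ => max s 0 ^ 2) (2 * max t 0) t := by
  rcases lt_trichotomy t 0 with h | h | h
  · rw [max_eq_right h.le, mul_zero]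
    refine (hasDerivAt_const t (0 : ℝ)).congr_of_eventuallyEq ?_
    filter_upwards [Iio_mem_nhds h] with s hs
    simp [max_eq_right (mem_Iio.1 hs).le]
  · subst h
    simp only [max_self, mul_zero]
    rw [hasDerivAt_iff_isLittleO_nhds_zero]
    have h1 : (fun h : ℝ => h ^ 2) =o[𝓝 0] fun h : ℝ => h := by
      simpa using Asymptotics.isLittleO_pow_pow (𝕜 := ℝ) (one_lt_two)
    refine Asymptotics.IsBigO.trans_isLittleO ?_ h1
    refine Asymptotics.IsBigO.of_bound 1 (Eventually.of_forall fun s => ?_)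
    rcases le_total s 0 with hs | hs <;> simp [hs, sq_nonneg]
  · rw [max_eq_left h.le]
    have h2 : HasDerivAt (fun s : ℝ => s ^ 2) (2 * t) t := by simpa using hasDerivAt_pow 2 t
    refine h2.congr_of_eventuallyEq ?_
    filter_upwards [Ioi_mem_nhds h] with s hs
    simp [max_eq_left (mem_Ioi.1 hs).le]

theorem softPos_radicand_pos {δ : ℝ} (hδ : 0 < δ) (t : ℝ) : 0 < max t 0 ^ 2 + δ ^ 2 := by
  positivity

theorem hasDerivAt_softPos {δ : ℝ} (hδ : 0 < δ) (t : ℝ) :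
    HasDerivAt (softPos δ) (softPosDeriv δ t) t := by
  have h := (((hasDerivAt_max_zero_sq t).add_const (δ ^ 2)).sqrt
    (softPos_radicand_pos hδ t).ne').sub_const δ
  convert! h using 1
  unfold softPosDeriv
  rw [mul_div_mul_left _ _ two_ne_zero]

theorem continuous_softPosDeriv {δ : ℝ} (hδ : 0 < δ) : Continuous (softPosDeriv δ) := by
  unfold softPosDeriv
  refine Continuous.div (by fun_prop) (by fun_prop) fun t => ?_
  exact (Real.sqrt_pos.2 (softPos_radicand_pos hδ t)).ne'

theorem abs_softPosDeriv_le_one {δ : ℝ} (hδ : 0 < δ) (t : ℝ) : |softPosDeriv δ t| ≤ 1 := by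
  have h := Real.sqrt_pos.2 (softPos_radicand_pos hδ t)
  have h0 : 0 ≤ max t 0 := le_max_right _ _
  unfold softPosDeriv
  rw [abs_of_nonneg (div_nonneg h0 h.le), div_le_one h]
  exact Real.le_sqrt_of_sq_le (by nlinarith)

theorem softPos_nonneg (δ : ℝ) (t : ℝ) : 0 ≤ softPos δ t := by
  unfold softPos
  have : δ ≤ √(max t 0 ^ 2 + δ ^ 2) := Real.le_sqrt_of_sq_le (by nlinarith [sq_nonneg (max t 0)])
  linarith

theorem softPos_le {δ : ℝ} (hδ : 0 < δ) (t : ℝ) : softPos δ t ≤ max t 0 := by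
  unfold softPos
  have h0 : 0 ≤ max t 0 := le_max_right _ _
  have : √(max t 0 ^ 2 + δ ^ 2) ≤ max t 0 + δ := by
    rw [Real.sqrt_le_left (by positivity)]
    nlinarith
  linarith

theorem max_sub_le_softPos (δ : ℝ) (t : ℝ) : max t 0 - δ ≤ softPos δ t := by
  unfold softPos
  have : max t 0 ≤ √(max t 0 ^ 2 + δ ^ 2) := Real.le_sqrt_of_sq_le (by nlinarith)
  linarith

theorem softPos_of_nonpos {δ : ℝ} (hδ : 0 < δ) {t : ℝ} (ht : t ≤ 0) : softPos δ t = 0 := by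
  simp [softPos, max_eq_right ht, Real.sqrt_sq hδ.le]

theorem softPos_pos (δ : ℝ) {t : ℝ} (ht : 0 < t) : 0 < softPos δ t := by
  unfold softPos
  have : δ < √(max t 0 ^ 2 + δ ^ 2) := by
    apply Real.lt_sqrt_of_sq_lt
    have : 0 < max t 0 := lt_max_of_lt_left ht
    nlinarith [pow_pos this 2]
  linarith

theorem softPosDeriv_nonneg (δ t : ℝ) : 0 ≤ softPosDeriv δ t :=
  div_nonneg (le_max_right _ _) (Real.sqrt_nonneg _)

theorem softPosDeriv_of_nonpos (δ : ℝ) {t : ℝ} (ht : t ≤ 0) : softPosDeriv δ t = 0 := by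
  simp [softPosDeriv, max_eq_right ht]

theorem tendsto_softPosDeriv (t : ℝ) :
    Tendsto (fun δ => softPosDeriv δ t) (𝓝 0) (𝓝 ((Ioi (0 : ℝ)).indicator 1 t)) := by
  by_cases ht : 0 < t
  · have h : ContinuousAt (fun δ => softPosDeriv δ t) 0 := by
      unfold softPosDeriv
      refine ContinuousAt.div (by fun_prop) (by fun_prop) ?_
      simp [max_eq_left ht.le, Real.sqrt_sq ht.le, ht.ne']
    have h2 := h.tendsto
    simp only [softPosDeriv, max_eq_left ht.le] at h2 ⊢
    simpa [ht, Real.sqrt_sq ht.le, div_self ht.ne'] using h2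
  · simp [softPosDeriv_of_nonpos _ (not_lt.1 ht), ht]

/-! ### The weights -/

/-- For a Caratheodory function the infimum defining `lam` may be taken over a countable dense
set of directions. -/
theorem aemeasurable_lam {Ω : Set (E d)} {p : ℝ} {a : E d → E d → E d}
    (ha : IsCaratheodory Ω a) : AEMeasurable (lam p a) (volume.restrict Ω) := by
  let D := TopologicalSpace.denseSeq (E d)
  let f : E d → E d → ℝ≥0∞ := fun ξ x => ENNReal.ofReal (inner ℝ (a x ξ) ξ / ‖ξ‖ ^ p)
  have hf : ∀ ξ, AEMeasurable (f ξ) (volume.restrict Ω) := fun ξ =>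
    (((ha.1 ξ).inner aemeasurable_const).div_const _).ennreal_ofReal
  have hm : AEMeasurable (fun x => ⨅ n, ⨅ (_ : D n ≠ 0), f (D n) x) (volume.restrict Ω) :=
    AEMeasurable.iInf fun n => AEMeasurable.iInf fun _ => hf (D n)
  refine hm.congr ?_
  filter_upwards [ha.2] with x hx
  refine le_antisymm (le_iInf₂ fun ξ hξ => ?_) (le_iInf₂ fun n hn => iInf₂_le (D n) hn)
  -- If the value at `ξ` were below the infimum over the dense directions, so would be the values
  -- at nearby directions, in contradiction to density.
  by_contra! hlt
  have hc : ContinuousAt (fun ξ => f ξ x) ξ := by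
    refine ENNReal.continuous_ofReal.continuousAt.comp ?_
    refine ContinuousAt.div (by fun_prop) ?_ ?_
    · exact continuous_norm.continuousAt.rpow_const (Or.inl (norm_ne_zero_iff.2 hξ))
    · exact (Real.rpow_pos_of_pos (norm_pos_iff.2 hξ) p).ne'
  have hU : {ζ | (f ζ x < ⨅ n, ⨅ (_ : D n ≠ 0), f (D n) x) ∧ ζ ≠ 0} ∈ 𝓝 ξ :=
    (hc.eventually_lt continuousAt_const hlt).and (isOpen_ne.mem_nhds hξ)
  obtain ⟨V, hV, hVo, hξV⟩ := mem_nhds_iff.1 hU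
  obtain ⟨n, hn⟩ := (TopologicalSpace.denseRange_denseSeq (E d)).exists_mem_open hVo ⟨ξ, hξV⟩
  exact absurd (iInf₂_le n (hV hn).2) (not_le.2 (hV hn).1)

/-- By the Cauchy-Schwarz inequality `(a·ξ)^p ≤ |a|^p |ξ|^p`. -/
theorem lam_le_mu [Nontrivial (E d)] {p : ℝ} (hp : 1 < p) (a : E d → E d → E d) (x : E d) :
    lam p a x ≤ mu p a x := by
  obtain ⟨ξ, hξ⟩ := exists_ne (0 : E d)
  refine (iInf₂_le ξ hξ).trans (le_trans ?_ (le_iSup₂ (f := fun (ξ : E d) (_ : ξ ≠ 0) =>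
    ‖a x ξ‖ₑ ^ p / ENNReal.ofReal (inner ℝ (a x ξ) ξ) ^ (p - 1)) ξ hξ))
  set s := inner ℝ (a x ξ) ξ with hs
  have hξ0 : 0 < ‖ξ‖ := norm_pos_iff.2 hξ
  -- For `s ≤ 0` the quotient in `lam` is truncated to zero.
  rcases le_or_gt s 0 with h | h
  · rw [ENNReal.ofReal_of_nonpos (div_nonpos_of_nonpos_of_nonneg h (by positivity))]
    exact bot_le
  have hsp : 0 < s ^ (p - 1) := Real.rpow_pos_of_pos h _
  have hcs : s ≤ ‖a x ξ‖ * ‖ξ‖ := real_inner_le_norm _ _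
  have key : s / ‖ξ‖ ^ p ≤ ‖a x ξ‖ ^ p / s ^ (p - 1) := by
    rw [div_le_div_iff₀ (by positivity) hsp, ← Real.mul_rpow (norm_nonneg _) hξ0.le]
    calc s * s ^ (p - 1) = s ^ p := by
          rw [← Real.rpow_one_add' h.le (by linarith)]; ring_nf
      _ ≤ _ := Real.rpow_le_rpow h.le hcs (by linarith)
  calc ENNReal.ofReal (s / ‖ξ‖ ^ p) ≤ ENNReal.ofReal (‖a x ξ‖ ^ p / s ^ (p - 1)) :=
        ENNReal.ofReal_le_ofReal key
    _ = _ := by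
      rw [ENNReal.ofReal_div_of_pos hsp, ENNReal.ofReal_rpow_of_pos h,
        ← ENNReal.ofReal_rpow_of_nonneg (norm_nonneg _) (by linarith), ofReal_norm]

/-- Coercivity: `λ(x) |ξ|^p ≤ a(x,ξ)·ξ`, also for `ξ = 0`. -/
theorem lam_mul_le {p : ℝ} (hp : 1 < p) (a : E d → E d → E d) (x ξ : E d) :
    lam p a x * ‖ξ‖ₑ ^ p ≤ ENNReal.ofReal (inner ℝ (a x ξ) ξ) := by
  have hp0 : 0 < p := by linarith
  rcases eq_or_ne ξ 0 with rfl | hξ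
  · simp [hp0]
  have hn : 0 < ‖ξ‖ ^ p := Real.rpow_pos_of_pos (norm_pos_iff.2 hξ) p
  calc lam p a x * ‖ξ‖ₑ ^ p
      ≤ ENNReal.ofReal (inner ℝ (a x ξ) ξ / ‖ξ‖ ^ p) * ENNReal.ofReal (‖ξ‖ ^ p) := by
        rw [← ENNReal.ofReal_rpow_of_nonneg (norm_nonneg _) hp0.le, ofReal_norm]
        gcongr
        exact iInf₂_le ξ hξ
    _ = _ := by
        rw [← ENNReal.ofReal_mul' hn.le, div_mul_cancel₀ _ hn.ne']

/-! ### Weighted integrals -/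

section Weighted

variable {α : Type*} [MeasurableSpace α] {ν : Measure α}

/-- Hölder's inequality for `F = (l^{1/p} F) · l^{-1/p}`. -/
theorem lintegral_le_weighted {p : ℝ} (hp : 1 < p) {l F : α → ℝ≥0∞} (hl : AEMeasurable l ν)
    (hlt : ∀ᵐ x ∂ν, l x ≠ ∞) (hl0 : ∀ᵐ x ∂ν, l x ≠ 0) (hF : AEMeasurable F ν) :
    ∫⁻ x, F x ∂ν ≤ (∫⁻ x, l x * F x ^ p ∂ν) ^ (1 / p) *
      (∫⁻ x, (l x)⁻¹ ^ (1 / (p - 1)) ∂ν) ^ ((p - 1) / p) := by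
  have hp0 : 0 < p := by linarith
  have hp1 : 0 < p - 1 := by linarith
  have hpq : p.HolderConjugate (p / (p - 1)) := Real.HolderConjugate.conjExponent hp
  have h := ENNReal.lintegral_mul_le_Lp_mul_Lq ν hpq (f := fun x => l x ^ (1 / p) * F x)
    (g := fun x => (l x)⁻¹ ^ (1 / p)) ((hl.pow_const _).mul hF) (hl.inv.pow_const _)
  have e1 : ∫⁻ x, F x ∂ν =
      ∫⁻ x, ((fun x => l x ^ (1 / p) * F x) * fun x => (l x)⁻¹ ^ (1 / p)) x ∂ν := by
    refine lintegral_congr_ae ?_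
    filter_upwards [hlt, hl0] with x h1 h2
    have h3 : l x ^ (1 / p) ≠ 0 := by simp [ENNReal.rpow_eq_zero_iff, h1, h2]
    have h4 : l x ^ (1 / p) ≠ ∞ := ENNReal.rpow_ne_top_of_nonneg (by positivity) h1
    rw [Pi.mul_apply, ENNReal.inv_rpow, mul_comm (l x ^ (1 / p)), mul_assoc,
      ENNReal.mul_inv_cancel h3 h4, mul_one]
  rw [e1]
  refine h.trans_eq ?_
  congr 2
  · refine lintegral_congr fun x => ?_
    rw [ENNReal.mul_rpow_of_nonneg _ _ hp0.le, ← ENNReal.rpow_mul, one_div_mul_cancel hp0.ne',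
      ENNReal.rpow_one]
  · refine lintegral_congr fun x => ?_
    rw [← ENNReal.rpow_mul]
    congr 1
    field_simp
  · field_simp

/-- If `∫ l F_n^p → 0` and `l⁻¹ ∈ L^{1/(p-1)}`, then `F_n → 0` in `L^1`. -/
theorem tendsto_lintegral_of_weighted {p : ℝ} (hp : 1 < p) {l : α → ℝ≥0∞} (hl : AEMeasurable l ν)
    (hlt : ∀ᵐ x ∂ν, l x ≠ ∞) (hl0 : ∀ᵐ x ∂ν, l x ≠ 0)
    (hint : ∫⁻ x, (l x)⁻¹ ^ (1 / (p - 1)) ∂ν < ∞) {F : ℕ → α → ℝ≥0∞}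
    (hF : ∀ n, AEMeasurable (F n) ν)
    (h : Tendsto (fun n => ∫⁻ x, l x * F n x ^ p ∂ν) atTop (𝓝 0)) :
    Tendsto (fun n => ∫⁻ x, F n x ∂ν) atTop (𝓝 0) := by
  have hp0 : 0 < p := by linarith
  have h2 : (∫⁻ x, (l x)⁻¹ ^ (1 / (p - 1)) ∂ν) ^ ((p - 1) / p) ≠ ∞ :=
    ENNReal.rpow_ne_top_of_nonneg (div_nonneg (by linarith) hp0.le) hint.ne
  have h1 := h.ennrpow_const (1 / p)
  rw [ENNReal.zero_rpow_of_pos (by positivity)] at h1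
  have h3 := ENNReal.Tendsto.mul_const h1 (Or.inr h2)
  rw [zero_mul] at h3
  exact tendsto_of_tendsto_of_tendsto_of_le_of_le tendsto_const_nhds h3 (fun _ => zero_le)
    fun n => lintegral_le_weighted hp hl hlt hl0 (hF n)

theorem exists_subseq_tendsto_ae {u : ℕ → α → ℝ} {v : α → ℝ}
    (hu : ∀ n, AEStronglyMeasurable (u n) ν) (hv : AEStronglyMeasurable v ν)
    (h : Tendsto (fun n => ∫⁻ x, ‖u n x - v x‖ₑ ∂ν) atTop (𝓝 0)) :
    ∃ s : ℕ → ℕ, StrictMono s ∧ ∀ᵐ x ∂ν, Tendsto (fun n => u (s n) x) atTop (𝓝 (v x)) := by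
  refine (tendstoInMeasure_of_tendsto_eLpNorm (p := 1) one_ne_zero hu hv ?_).exists_seq_tendsto_ae
  simpa [eLpNorm_one_eq_lintegral_enorm] using h

/-- Continuity of `(u, G) ↦ g(u) G` for a bounded continuous `g`, in a weighted `L^q`:
`g(u_n) G_n - g(u) G = g(u_n) (G_n - G) + (g(u_n) - g(u)) G`, where the second term is dominated
by `2 |G|` and tends to zero almost everywhere. -/
theorem tendsto_lintegral_smul_comp {q : ℝ} (hq : 1 ≤ q) {ω : α → ℝ≥0∞} (hω : AEMeasurable ω ν)
    {g : ℝ → ℝ} (hg : Continuous g) (hg1 : ∀ t, |g t| ≤ 1)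
    {u : ℕ → α → ℝ} {v : α → ℝ} {G : ℕ → α → E d} {H : α → E d}
    (hu : ∀ n, AEStronglyMeasurable (u n) ν) (hv : AEStronglyMeasurable v ν)
    (hG : ∀ n, AEStronglyMeasurable (G n) ν) (hH : AEStronglyMeasurable H ν)
    (hae : ∀ᵐ x ∂ν, Tendsto (fun n => u n x) atTop (𝓝 (v x)))
    (hfin : ∫⁻ x, ω x * ‖H x‖ₑ ^ q ∂ν < ∞)
    (h : Tendsto (fun n => ∫⁻ x, ω x * ‖G n x - H x‖ₑ ^ q ∂ν) atTop (𝓝 0)) :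
    Tendsto (fun n => ∫⁻ x, ω x * ‖g (u n x) • G n x - g (v x) • H x‖ₑ ^ q ∂ν) atTop (𝓝 0) := by
  have hq0 : 0 < q := by linarith
  let r : ℕ → α → ℝ≥0∞ := fun n x => ‖g (u n x) - g (v x)‖ₑ ^ q * (ω x * ‖H x‖ₑ ^ q)
  have hHm : AEMeasurable (fun x => ω x * ‖H x‖ₑ ^ q) ν := hω.mul (hH.enorm.pow_const _)
  have hr : Tendsto (fun n => ∫⁻ x, r n x ∂ν) atTop (𝓝 (∫⁻ _, 0 ∂ν)) := by
    refine tendsto_lintegral_of_dominated_convergence' (fun x => 2 ^ q * (ω x * ‖H x‖ₑ ^ q))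
      (fun n => ?_) (fun n => Eventually.of_forall fun x => ?_) ?_ ?_
    · exact (((hg.comp_aestronglyMeasurable (hu n)).sub
        (hg.comp_aestronglyMeasurable hv)).enorm.pow_const _).mul hHm
    · dsimp only [r]
      gcongr
      refine (enorm_sub_le).trans ?_
      rw [← one_add_one_eq_two]
      gcongr <;>
      · rw [← ofReal_norm, Real.norm_eq_abs]
        exact ENNReal.ofReal_le_one.2 (hg1 _)
    · rw [lintegral_const_mul'' _ hHm]
      exact (ENNReal.mul_lt_top (ENNReal.rpow_lt_top_of_nonneg hq0.le (by simp)) hfin).ne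
    · filter_upwards [hae, ae_lt_top' hHm hfin.ne] with x hx hxf
      have h1 : Tendsto (fun n => ‖g (u n x) - g (v x)‖ₑ ^ q) atTop (𝓝 0) := by
        have h2 : Tendsto (fun n => g (u n x) - g (v x)) atTop (𝓝 0) := by
          simpa using ((hg.tendsto (v x)).comp hx).sub_const (g (v x))
        have h3 := (h2.enorm).ennrpow_const q
        simpa [ENNReal.zero_rpow_of_pos hq0] using h3
      simpa using ENNReal.Tendsto.mul_const h1 (Or.inr hxf.ne)
  rw [lintegral_zero] at hr
  have hsum := ENNReal.Tendsto.const_mul (a := (2 : ℝ≥0∞) ^ (q - 1)) (h.add hr)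
    (Or.inr (ENNReal.rpow_ne_top_of_nonneg (by linarith) (by simp)))
  rw [add_zero, mul_zero] at hsum
  refine tendsto_of_tendsto_of_tendsto_of_le_of_le tendsto_const_nhds hsum (fun _ => zero_le)
    fun n => ?_
  have hGm : AEMeasurable (fun x => ω x * ‖G n x - H x‖ₑ ^ q) ν :=
    hω.mul (((hG n).sub hH).enorm.pow_const _)
  dsimp only
  rw [← lintegral_add_left' hGm, ← lintegral_const_mul' _ _
    (ENNReal.rpow_ne_top_of_nonneg (by linarith) (by simp))]
  refine lintegral_mono fun x => ?_
  have e : g (u n x) • G n x - g (v x) • H x =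
      g (u n x) • (G n x - H x) + (g (u n x) - g (v x)) • H x := by
    rw [smul_sub, sub_smul]; abel
  have h1 : ‖g (u n x)‖ₑ ≤ 1 := by
    rw [← ofReal_norm, Real.norm_eq_abs]
    exact ENNReal.ofReal_le_one.2 (hg1 _)
  calc ω x * ‖g (u n x) • G n x - g (v x) • H x‖ₑ ^ q
      ≤ ω x * (‖G n x - H x‖ₑ + ‖g (u n x) - g (v x)‖ₑ * ‖H x‖ₑ) ^ q := by
        gcongr
        rw [e]
        refine (enorm_add_le _ _).trans ?_
        rw [enorm_smul, enorm_smul]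
        gcongr
        exact mul_le_of_le_one_left' h1
    _ ≤ ω x * (2 ^ (q - 1) * (‖G n x - H x‖ₑ ^ q +
          (‖g (u n x) - g (v x)‖ₑ * ‖H x‖ₑ) ^ q)) := by
        gcongr
        exact ENNReal.rpow_add_le_mul_rpow_add_rpow _ _ hq
    _ = _ := by
        rw [ENNReal.mul_rpow_of_nonneg _ _ hq0.le]
        dsimp only [r]
        ring

end Weighted

/-! ### Gradients and weak gradients -/

theorem gradient_comp_left {η : ℝ → ℝ} {η' : ℝ} {f : E d → ℝ} {x : E d}
    (hη : HasDerivAt η η' (f x)) (hf : DifferentiableAt ℝ f x) :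
    gradient (fun y => η (f y)) x = η' • gradient f x := by
  refine HasGradientAt.gradient ?_
  have h := hη.comp_hasFDerivAt x hf.hasGradientAt.hasFDerivAt
  rw [hasGradientAt_iff_hasFDerivAt, map_smul]
  exact h

theorem norm_gradient (f : E d → ℝ) (x : E d) : ‖gradient f x‖ = ‖fderiv ℝ f x‖ := by
  simp [gradient]

theorem continuousOn_gradient {U : Set (E d)} (hU : IsOpen U) {f : E d → ℝ}
    (hf : ContDiffOn ℝ 1 f U) : ContinuousOn (gradient f) U :=
  (LinearIsometryEquiv.continuous _).comp_continuousOn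
    (hf.continuousOn_fderiv_of_isOpen hU le_rfl)

theorem aestronglyMeasurable_gradient {U : Set (E d)} (hU : IsOpen U) {f : E d → ℝ}
    (hf : ContDiffOn ℝ 1 f U) : AEStronglyMeasurable (gradient f) (volume.restrict U) :=
  (continuousOn_gradient hU hf).aestronglyMeasurable hU.measurableSet

theorem integrable_mul_of_continuousOn {U : Set (E d)} {f g : E d → ℝ} (hf : ContinuousOn f U)
    (hg : Continuous g) (hc : HasCompactSupport g) (hs : tsupport g ⊆ U) :
    Integrable (fun x => f x * g x) := by
  have h : IntegrableOn (fun x => f x * g x) (tsupport g) :=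
    ((hf.mono hs).mul hg.continuousOn).integrableOn_compact hc
  rw [integrableOn_iff_integrable_of_support_subset] at h
  · exact h
  · intro x hx
    by_contra hx'
    exact hx (by simp [image_eq_zero_of_notMem_tsupport hx'])

theorem memW11_of_contDiffOn {U : Set (E d)} (hU : IsOpen U) {f : E d → ℝ}
    (hf : ContDiffOn ℝ 1 f U) (h1 : IntegrableOn f U) (h2 : IntegrableOn (gradient f) U) :
    MemW11 U f (gradient f) := by
  refine ⟨h1, h2, h1.locallyIntegrableOn, h2.locallyIntegrableOn, fun ψ hψ hc hs e => ?_⟩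
  have hd : Continuous fun x => fderiv ℝ ψ x e :=
    (hψ.continuous_fderiv (by simp)).clm_apply continuous_const
  have hdc : HasCompactSupport fun x => fderiv ℝ ψ x e := hc.fderiv_apply ℝ e
  have hds : tsupport (fun x => fderiv ℝ ψ x e) ⊆ U := (tsupport_fderiv_apply_subset ℝ e).trans hs
  have hg : ContinuousOn (fun x => fderiv ℝ f x e) U :=
    (hf.continuousOn_fderiv_of_isOpen hU le_rfl).clm_apply continuousOn_const
  simp only [inner_gradient_left]
  rw [setIntegral_eq_integral_of_forall_compl_eq_zero (s := U),
    setIntegral_eq_integral_of_forall_compl_eq_zero (s := U)]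
  · exact integral_mul_fderiv_eq_neg_fderiv_mul_of_integrable
      (integrable_mul_of_continuousOn hg hψ.continuous hc hs)
      (integrable_mul_of_continuousOn hf.continuousOn hd hdc hds)
      (integrable_mul_of_continuousOn hf.continuousOn hψ.continuous hc hs)
      (fun x hx => (hf.differentiableOn one_ne_zero).differentiableAt (hU.mem_nhds (hs hx)))
      (fun x _ => (hψ.differentiable (by simp)).differentiableAt)
  · intro x hx
    simp [image_eq_zero_of_notMem_tsupport fun h => hx (hs h)]
  · intro x hx
    simp only [mul_eq_zero]
    exact Or.inr (image_eq_zero_of_notMem_tsupport (f := fun x => fderiv ℝ ψ x e)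
      fun h => hx (hds h))

theorem tendsto_integral_mul_of_bounded {α : Type*} [MeasurableSpace α] {ν : Measure α}
    {v : ℕ → α → ℝ} {w ψ : α → ℝ} {C : ℝ} (hψ : AEStronglyMeasurable ψ ν) (hC : ∀ x, ‖ψ x‖ ≤ C)
    (hv : ∀ n, Integrable (v n) ν) (hw : Integrable w ν)
    (h : Tendsto (fun n => ∫⁻ x, ‖v n x - w x‖ₑ ∂ν) atTop (𝓝 0)) :
    Tendsto (fun n => ∫ x, v n x * ψ x ∂ν) atTop (𝓝 (∫ x, w x * ψ x ∂ν)) := by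
  refine tendsto_integral_of_L1 _ (hw.aestronglyMeasurable.mul hψ)
    (Eventually.of_forall fun n => (hv n).mul_bdd hψ (Eventually.of_forall hC)) ?_
  have h2 := ENNReal.Tendsto.mul_const h (Or.inr (ENNReal.ofReal_ne_top (r := C)))
  rw [zero_mul] at h2
  refine tendsto_of_tendsto_of_tendsto_of_le_of_le tendsto_const_nhds h2 (fun _ => zero_le)
    fun n => ?_
  dsimp only
  rw [← lintegral_mul_const' _ _ ENNReal.ofReal_ne_top]
  refine lintegral_mono fun x => ?_
  rw [Pi.mul_apply, ← sub_mul, enorm_mul]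
  gcongr
  rw [← ofReal_norm]
  exact ENNReal.ofReal_le_ofReal (hC x)

/-- `W^{1,1}` convergence preserves the weak gradient. -/
theorem memW11_of_tendsto {U : Set (E d)} {v : ℕ → E d → ℝ} {V : ℕ → E d → E d}
    {w : E d → ℝ} {W : E d → E d} (h : ∀ n, MemW11 U (v n) (V n)) (hw : IntegrableOn w U)
    (hW : IntegrableOn W U)
    (h1 : Tendsto (fun n => ∫⁻ x in U, ‖v n x - w x‖ₑ) atTop (𝓝 0))
    (h2 : Tendsto (fun n => ∫⁻ x in U, ‖V n x - W x‖ₑ) atTop (𝓝 0)) : MemW11 U w W := by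
  refine ⟨hw, hW, hw.locallyIntegrableOn, hW.locallyIntegrableOn, fun ψ hψ hc hs e => ?_⟩
  have hd : Continuous fun x => fderiv ℝ ψ x e :=
    (hψ.continuous_fderiv (by simp)).clm_apply continuous_const
  have hdc : HasCompactSupport fun x => fderiv ℝ ψ x e := hc.fderiv_apply ℝ e
  obtain ⟨C1, hC1⟩ := hd.bounded_above_of_compact_support hdc
  obtain ⟨C2, hC2⟩ := hψ.continuous.bounded_above_of_compact_support hc
  have t1 := tendsto_integral_mul_of_bounded hd.aestronglyMeasurable hC1
    (fun n => (h n).1) hw h1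
  have h3 : Tendsto (fun n => ∫⁻ x in U, ‖inner ℝ (V n x) e - inner ℝ (W x) e‖ₑ)
      atTop (𝓝 0) := by
    have h4 := ENNReal.Tendsto.mul_const h2 (Or.inr (enorm_ne_top (x := e)))
    rw [zero_mul] at h4
    refine tendsto_of_tendsto_of_tendsto_of_le_of_le tendsto_const_nhds h4 (fun _ => zero_le)
      fun n => ?_
    dsimp only
    rw [← lintegral_mul_const' _ _ enorm_ne_top]
    refine lintegral_mono fun x => ?_
    rw [← inner_sub_left, ← ofReal_norm, ← ofReal_norm, ← ofReal_norm,
      ← ENNReal.ofReal_mul (norm_nonneg _)]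
    exact ENNReal.ofReal_le_ofReal (norm_inner_le_norm _ _)
  have t2 := (tendsto_integral_mul_of_bounded hψ.continuous.aestronglyMeasurable hC2
    (fun n => (h n).2.1.inner_const e) (hW.inner_const e) h3).neg
  refine tendsto_nhds_unique t1 (t2.congr fun n => ?_)
  exact ((h n).2.2.2.2 ψ hψ hc hs e).symm

/-! ### Truncations of limits of smooth functions -/

theorem abs_sub_le_of_hasDerivAt {η η' : ℝ → ℝ} (hη : ∀ t, HasDerivAt η (η' t) t)
    (hη1 : ∀ t, |η' t| ≤ 1) (s t : ℝ) : |η s - η t| ≤ |s - t| := by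
  have h := Convex.norm_image_sub_le_of_norm_hasDerivWithin_le (f := η) (f' := η') (s := univ)
    (C := 1) (x := t) (y := s) (fun x _ => (hη x).hasDerivWithinAt) (fun x _ => hη1 x)
    convex_univ (mem_univ _) (mem_univ _)
  simpa using h

theorem enorm_sub_le_of_hasDerivAt {η η' : ℝ → ℝ} (hη : ∀ t, HasDerivAt η (η' t) t)
    (hη1 : ∀ t, |η' t| ≤ 1) (s t : ℝ) : ‖η s - η t‖ₑ ≤ ‖s - t‖ₑ := by
  rw [← ofReal_norm, ← ofReal_norm]
  exact ENNReal.ofReal_le_ofReal (abs_sub_le_of_hasDerivAt hη hη1 s t)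

/-- A sequence of `C^1` functions converging to `u` in `W^{1,1}(U)` and almost everywhere,
with `G` the limit of the gradients. -/
structure W11Approx (U : Set (E d)) (φ : ℕ → E d → ℝ) (u : E d → ℝ) (G : E d → E d) : Prop where
  contDiffOn : ∀ n, ContDiffOn ℝ 1 (φ n) U
  integrableOn : IntegrableOn u U
  integrableOn_grad : IntegrableOn G U
  tendsto : Tendsto (fun n => ∫⁻ x in U, ‖φ n x - u x‖ₑ) atTop (𝓝 0)
  tendsto_grad : Tendsto (fun n => ∫⁻ x in U, ‖gradient (φ n) x - G x‖ₑ) atTop (𝓝 0)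
  tendsto_ae : ∀ᵐ x ∂(volume.restrict U), Tendsto (fun n => φ n x) atTop (𝓝 (u x))

theorem W11Approx.mono {U U' : Set (E d)} {φ : ℕ → E d → ℝ} {u : E d → ℝ} {G : E d → E d}
    (h : W11Approx U φ u G) (hU : U' ⊆ U) : W11Approx U' φ u G where
  contDiffOn n := (h.contDiffOn n).mono hU
  integrableOn := h.integrableOn.mono_set hU
  integrableOn_grad := h.integrableOn_grad.mono_set hU
  tendsto := tendsto_of_tendsto_of_tendsto_of_le_of_le tendsto_const_nhds h.tendsto
    (fun _ => zero_le) fun _ => lintegral_mono_set hU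
  tendsto_grad := tendsto_of_tendsto_of_tendsto_of_le_of_le tendsto_const_nhds h.tendsto_grad
    (fun _ => zero_le) fun _ => lintegral_mono_set hU
  tendsto_ae := ae_restrict_of_ae_restrict_of_subset hU h.tendsto_ae

theorem W11Approx.comp {U : Set (E d)} (hU : IsOpen U) {φ : ℕ → E d → ℝ} {u : E d → ℝ}
    {G : E d → E d} (h : W11Approx U φ u G) {η η' : ℝ → ℝ} (hη : ∀ t, HasDerivAt η (η' t) t)
    (hη' : Continuous η') (hη1 : ∀ t, |η' t| ≤ 1) (hη0 : ∀ t, |η t| ≤ |t|) :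
    W11Approx U (fun n x => η (φ n x)) (fun x => η (u x)) (fun x => η' (u x) • G x) := by
  have hηc : ContDiff ℝ 1 η := by
    rw [contDiff_one_iff_deriv, funext fun t => (hη t).deriv]
    exact ⟨fun t => (hη t).differentiableAt, hη'⟩
  refine ⟨fun n => hηc.comp_contDiffOn (h.contDiffOn n), ?_, ?_, ?_, ?_, ?_⟩
  · exact Integrable.mono h.integrableOn
      (hηc.continuous.comp_aestronglyMeasurable h.integrableOn.aestronglyMeasurable)
      (Eventually.of_forall fun x => hη0 _)
  · refine Integrable.mono h.integrableOn_grad ((hη'.comp_aestronglyMeasurable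
      h.integrableOn.aestronglyMeasurable).smul h.integrableOn_grad.aestronglyMeasurable)
      (Eventually.of_forall fun x => ?_)
    rw [norm_smul]
    exact mul_le_of_le_one_left (norm_nonneg _) (hη1 _)
  · exact tendsto_of_tendsto_of_tendsto_of_le_of_le tendsto_const_nhds h.tendsto
      (fun _ => zero_le) fun n => lintegral_mono fun x => enorm_sub_le_of_hasDerivAt hη hη1 _ _
  · have h1 := tendsto_lintegral_smul_comp (q := 1) le_rfl (ω := fun _ => 1)
      (ν := volume.restrict U) aemeasurable_const hη' hη1
      (fun n => (h.contDiffOn n).continuousOn.aestronglyMeasurable hU.measurableSet)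
      h.integrableOn.aestronglyMeasurable
      (fun n => aestronglyMeasurable_gradient hU (h.contDiffOn n))
      h.integrableOn_grad.aestronglyMeasurable h.tendsto_ae
      (by simpa [HasFiniteIntegral] using h.integrableOn_grad.hasFiniteIntegral)
      (by simpa using h.tendsto_grad)
    simp only [ENNReal.rpow_one, one_mul] at h1
    refine h1.congr fun n => setLIntegral_congr_fun hU.measurableSet fun x hx => ?_
    rw [gradient_comp_left (hη _)
      (((h.contDiffOn n).differentiableOn one_ne_zero).differentiableAt (hU.mem_nhds hx))]
  · filter_upwards [h.tendsto_ae] with x hx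
    exact (hηc.continuous.tendsto _).comp hx

theorem integrableOn_of_lintegral_enorm_sub {U : Set (E d)} {F : Type*} [NormedAddCommGroup F]
    {f g : E d → F} (hf : AEStronglyMeasurable f (volume.restrict U)) (hg : IntegrableOn g U)
    (h : ∫⁻ x in U, ‖f x - g x‖ₑ < ∞) (hg' : AEStronglyMeasurable g (volume.restrict U)) :
    IntegrableOn f U := by
  have h1 : IntegrableOn (fun x => f x - g x) U := ⟨hf.sub hg', h⟩
  exact (h1.add hg).congr (Eventually.of_forall fun x => sub_add_cancel _ _)

theorem W11Approx.memW11 {U : Set (E d)} (hU : IsOpen U) {φ : ℕ → E d → ℝ} {u : E d → ℝ}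
    {G : E d → E d} (h : W11Approx U φ u G) : MemW11 U u G := by
  -- Only eventually are the approximating functions known to be in `W^{1,1}(U)`.
  have e : ∀ᶠ n in atTop, MemW11 U (φ n) (gradient (φ n)) := by
    filter_upwards [h.tendsto.eventually_lt_const one_pos,
      h.tendsto_grad.eventually_lt_const one_pos] with n h1 h2
    refine memW11_of_contDiffOn hU (h.contDiffOn n) ?_ ?_
    · exact integrableOn_of_lintegral_enorm_sub
        ((h.contDiffOn n).continuousOn.aestronglyMeasurable hU.measurableSet)
        h.integrableOn (h1.trans ENNReal.one_lt_top) h.integrableOn.aestronglyMeasurable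
    · exact integrableOn_of_lintegral_enorm_sub
        (aestronglyMeasurable_gradient hU (h.contDiffOn n))
        h.integrableOn_grad (h2.trans ENNReal.one_lt_top) h.integrableOn_grad.aestronglyMeasurable
  obtain ⟨N, hN⟩ := eventually_atTop.1 e
  exact memW11_of_tendsto (fun n => hN (n + N) (Nat.le_add_left _ _)) h.integrableOn
    h.integrableOn_grad ((tendsto_add_atTop_iff_nat N).2 h.tendsto)
    ((tendsto_add_atTop_iff_nat N).2 h.tendsto_grad)

theorem W11Approx.truncate {U : Set (E d)} (hU : IsOpen U) {φ : ℕ → E d → ℝ} {u : E d → ℝ}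
    {G : E d → E d} (h : W11Approx U φ u G) {δ : ℝ} (hδ : 0 < δ) :
    W11Approx U (fun n x => softPos δ (φ n x)) (fun x => softPos δ (u x))
      (fun x => softPosDeriv δ (u x) • G x) := by
  refine h.comp hU (hasDerivAt_softPos hδ) (continuous_softPosDeriv hδ)
    (abs_softPosDeriv_le_one hδ) fun t => ?_
  rw [abs_of_nonneg (softPos_nonneg δ t)]
  exact (softPos_le hδ t).trans (max_le (le_abs_self t) (abs_nonneg t))

/-- The weak gradient of `u₊` is `1_{u > 0} G`. -/
theorem W11Approx.memW11_max {U : Set (E d)} (hU : IsOpen U) {φ : ℕ → E d → ℝ} {u : E d → ℝ}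
    {G : E d → E d} (h : W11Approx U φ u G) :
    MemW11 U (fun x => max (u x) 0) (fun x => (Ioi (0 : ℝ)).indicator (1 : ℝ → ℝ) (u x) • G x) := by
  let δ : ℕ → ℝ := fun n => 1 / (n + 1 : ℝ)
  have hδ : ∀ n, 0 < δ n := fun n => by positivity
  have hδ0 : Tendsto δ atTop (𝓝 0) := tendsto_one_div_add_atTop_nhds_zero_nat
  have hum := h.integrableOn.aestronglyMeasurable
  have hi : AEStronglyMeasurable (fun x => (Ioi (0 : ℝ)).indicator (1 : ℝ → ℝ) (u x))
      (volume.restrict U) :=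
    (((measurable_const (a := (1 : ℝ))).indicator measurableSet_Ioi).comp_aemeasurable
      hum.aemeasurable).aestronglyMeasurable
  refine memW11_of_tendsto (fun n => (h.truncate hU (hδ n)).memW11 hU) ?_ ?_ ?_ ?_
  · exact h.integrableOn.pos_part
  · refine Integrable.mono h.integrableOn_grad (hi.smul h.integrableOn_grad.aestronglyMeasurable)
      (Eventually.of_forall fun x => ?_)
    rw [norm_smul]
    refine mul_le_of_le_one_left (norm_nonneg _) ?_
    by_cases hx : 0 < u x <;> simp [hx]
  · have t := tendsto_lintegral_norm_of_dominated_convergence (μ := volume.restrict U)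
      (F := fun n x => softPos (δ n) (u x)) (f := fun x => max (u x) 0) (bound := fun x => |u x|)
      (fun n => (h.truncate hU (hδ n)).integrableOn.aestronglyMeasurable)
      h.integrableOn.abs.hasFiniteIntegral
      (fun n => Eventually.of_forall fun x => ?_) (Eventually.of_forall fun x => ?_)
    · simpa only [ofReal_norm] using t
    · rw [Real.norm_eq_abs, abs_of_nonneg (softPos_nonneg _ _)]
      exact (softPos_le (hδ n) _).trans (max_le (le_abs_self _) (abs_nonneg _))
    · refine tendsto_of_tendsto_of_tendsto_of_le_of_le
        (g := fun n => max (u x) 0 - δ n) ?_ tendsto_const_nhds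
        (fun n => max_sub_le_softPos _ _) (fun n => softPos_le (hδ n) _)
      simpa using hδ0.const_sub (max (u x) 0)
  · have t := tendsto_lintegral_norm_of_dominated_convergence (μ := volume.restrict U)
      (F := fun n x => softPosDeriv (δ n) (u x) • G x)
      (f := fun x => (Ioi (0 : ℝ)).indicator (1 : ℝ → ℝ) (u x) • G x) (bound := fun x => ‖G x‖)
      (fun n => (h.truncate hU (hδ n)).integrableOn_grad.aestronglyMeasurable)
      h.integrableOn_grad.norm.hasFiniteIntegral
      (fun n => Eventually.of_forall fun x => ?_) (Eventually.of_forall fun x => ?_)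
    · simpa only [ofReal_norm] using t
    · rw [norm_smul]
      exact mul_le_of_le_one_left (norm_nonneg _) (abs_softPosDeriv_le_one (hδ n) _)
    · exact ((tendsto_softPosDeriv (u x)).comp hδ0).smul_const (G x)

/-! ### Circles and polar coordinates -/

/-- The point of the plane with polar coordinates `(ρ, θ)` about `z`. -/
noncomputable def circlePoint (z : E 2) (ρ θ : ℝ) : E 2 :=
  z + !₂[ρ * Real.cos θ, ρ * Real.sin θ]

theorem dist_circlePoint (z : E 2) {ρ : ℝ} (hρ : 0 ≤ ρ) (θ : ℝ) :
    dist (circlePoint z ρ θ) z = ρ := by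
  rw [circlePoint, dist_self_add_left, EuclideanSpace.norm_eq]
  simp only [Fin.sum_univ_two, Real.norm_eq_abs, sq_abs, Matrix.cons_val_zero,
    Matrix.cons_val_one]
  rw [mul_pow, mul_pow, ← mul_add, Real.cos_sq_add_sin_sq, mul_one, Real.sqrt_sq hρ]

theorem exists_circlePoint_eq {z x : E 2} {ρ : ℝ} (hx : x ∈ Metric.sphere z ρ) :
    ∃ θ ∈ Icc (-Real.pi) Real.pi, circlePoint z ρ θ = x := by
  let w : ℂ := ⟨(x - z) 0, (x - z) 1⟩
  have hw : ‖w‖ = ρ := by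
    rw [← Metric.mem_sphere.1 hx, dist_eq_norm, EuclideanSpace.norm_eq, Complex.norm_def,
      Complex.normSq_apply]
    simp [Fin.sum_univ_two, w, sq]
  refine ⟨w.arg, ⟨(Complex.neg_pi_lt_arg w).le, Complex.arg_le_pi w⟩, ?_⟩
  rw [circlePoint, ← hw, Complex.norm_mul_cos_arg, Complex.norm_mul_sin_arg]
  ext i
  fin_cases i <;> simp [w]

theorem hasDerivAt_circlePoint (z : E 2) (ρ θ : ℝ) :
    HasDerivAt (circlePoint z ρ) (!₂[-(ρ * Real.sin θ), ρ * Real.cos θ] : E 2) θ := by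
  unfold circlePoint
  refine HasDerivAt.const_add z ?_
  refine (PiLp.continuousLinearEquiv 2 ℝ fun _ : Fin 2 => ℝ).symm.hasFDerivAt.comp_hasDerivAt θ
    (f := fun θ => ![ρ * Real.cos θ, ρ * Real.sin θ])
    (f' := ![-(ρ * Real.sin θ), ρ * Real.cos θ]) (hasDerivAt_pi.2 fun i => ?_)
  fin_cases i
  · simpa using (Real.hasDerivAt_cos θ).const_mul ρ
  · simpa using (Real.hasDerivAt_sin θ).const_mul ρ

theorem continuous_circlePoint (z : E 2) :
    Continuous fun q : ℝ × ℝ => circlePoint z q.1 q.2 := by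
  unfold circlePoint
  refine continuous_const.add ((PiLp.continuous_toLp 2 _).comp (continuous_pi fun i => ?_))
  fin_cases i <;> simp <;> fun_prop

/-- Integration in polar coordinates about `z`. -/
theorem lintegral_circlePoint (z : E 2) {f : E 2 → ℝ≥0∞} (hf : Measurable f) :
    ∫⁻ ρ in Ioi (0 : ℝ), ENNReal.ofReal ρ *
      ∫⁻ θ in Ioo (-Real.pi) Real.pi, f (circlePoint z ρ θ) = ∫⁻ x, f x := by
  have hm : MeasurePreserving
      (fun q : ℝ × ℝ => z + WithLp.toLp 2 (MeasurableEquiv.finTwoArrow.symm q)) :=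
    (measurePreserving_add_left volume z).comp
      ((PiLp.volume_preserving_toLp (Fin 2)).comp (volume_preserving_finTwoArrow ℝ).symm)
  rw [← hm.lintegral_comp hf, ← lintegral_comp_polarCoord_symm]
  have hg : Measurable fun q : ℝ × ℝ => f (circlePoint z q.1 q.2) :=
    hf.comp (continuous_circlePoint z).measurable
  have e : ∀ q : ℝ × ℝ,
      (fun q : ℝ × ℝ => f (z + WithLp.toLp 2 (MeasurableEquiv.finTwoArrow.symm q)))
      (polarCoord.symm q) = f (circlePoint z q.1 q.2) := fun q => rfl
  simp only [smul_eq_mul]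
  simp_rw [e]
  rw [show polarCoord.target = Ioi (0 : ℝ) ×ˢ Ioo (-Real.pi) Real.pi from rfl,
    Measure.volume_eq_prod, ← Measure.prod_restrict, lintegral_prod]
  · refine lintegral_congr fun ρ => ?_
    dsimp only
    rw [lintegral_const_mul' _ _ ENNReal.ofReal_ne_top]
  · exact ((ENNReal.measurable_ofReal.comp measurable_fst).mul hg).aemeasurable

/-- On a circle, a `C^1` function is bounded by its `W^{1,1}` norm over the circle. -/
theorem enorm_le_lintegral_circle {U : Set (E 2)} (hU : IsOpen U) {w : E 2 → ℝ}
    (hw : ContDiffOn ℝ 1 w U) {z : E 2} {ρ : ℝ} (hρ : 0 ≤ ρ) (hs : Metric.sphere z ρ ⊆ U)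
    {x : E 2} (hx : x ∈ Metric.sphere z ρ) :
    ‖w x‖ₑ ≤ ∫⁻ θ in Ioo (-Real.pi) Real.pi, (‖w (circlePoint z ρ θ)‖ₑ +
      ENNReal.ofReal ρ * ‖gradient w (circlePoint z ρ θ)‖ₑ) := by
  obtain ⟨θ₀, hθ₀, rfl⟩ := exists_circlePoint_eq hx
  have hcU : ∀ θ, circlePoint z ρ θ ∈ U := fun θ => hs (dist_circlePoint z hρ θ)
  have hc : Continuous (circlePoint z ρ) :=
    (continuous_circlePoint z).comp (Continuous.prodMk_right ρ)
  let T : ℝ → E 2 := fun θ => !₂[-(ρ * Real.sin θ), ρ * Real.cos θ]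
  have hT : Continuous T := by
    refine (PiLp.continuous_toLp 2 _).comp (continuous_pi fun i => ?_)
    fin_cases i <;> simp <;> fun_prop
  have hTn : ∀ θ, ‖T θ‖ = ρ := fun θ => by
    rw [EuclideanSpace.norm_eq]
    simp only [T, Fin.sum_univ_two, Real.norm_eq_abs, sq_abs,
      Matrix.cons_val_zero, Matrix.cons_val_one]
    rw [neg_sq, mul_pow, mul_pow, ← mul_add, Real.sin_sq_add_cos_sq, mul_one, Real.sqrt_sq hρ]
  let g : ℝ → ℝ := fun θ => w (circlePoint z ρ θ)
  let g' : ℝ → ℝ := fun θ => inner ℝ (gradient w (circlePoint z ρ θ)) (T θ)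
  have hgrad : Continuous fun θ => gradient w (circlePoint z ρ θ) :=
    (continuousOn_gradient hU hw).comp_continuous hc hcU
  have hg' : Continuous g' := hgrad.inner hT
  have hg : ∀ θ, HasDerivAt g (g' θ) θ := fun θ => by
    have h1 := ((hw.differentiableOn one_ne_zero).differentiableAt
      (hU.mem_nhds (hcU θ))).hasFDerivAt.comp_hasDerivAt θ (hasDerivAt_circlePoint z ρ θ)
    rw [← inner_gradient_left] at h1
    exact h1
  set I := Ioo (-Real.pi) Real.pi with hI
  -- The oscillation along the circle, by the fundamental theorem of calculus.
  have hosc : ∀ θ ∈ I, ‖g θ₀‖ₑ ≤ ‖g θ‖ₑ + ∫⁻ t in I, ‖g' t‖ₑ := by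
    intro θ hθ
    have h1 : g θ₀ = g θ + ∫ t in θ..θ₀, g' t := by
      rw [intervalIntegral.integral_eq_sub_of_hasDerivAt (fun t _ => hg t)
        (hg'.intervalIntegrable _ _)]
      ring
    rw [h1]
    refine (enorm_add_le _ _).trans ?_
    gcongr
    have h2 : ‖∫ t in θ..θ₀, g' t‖ₑ = ‖∫ t in uIoc θ θ₀, g' t‖ₑ := by
      rw [← ofReal_norm, ← ofReal_norm, intervalIntegral.norm_integral_eq_norm_integral_uIoc]
    rw [h2]
    refine (enorm_integral_le_lintegral_enorm _).trans ?_
    rw [hI, restrict_Ioo_eq_restrict_Ioc]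
    refine lintegral_mono_set (Ioc_subset_Ioc (le_min hθ.1.le hθ₀.1) (max_le hθ.2.le hθ₀.2))
  have hvol : volume I = ENNReal.ofReal (2 * Real.pi) := by
    rw [hI, Real.volume_Ioo]; congr 1; ring
  have h1v : 1 ≤ volume I := by
    rw [hvol, ENNReal.one_le_ofReal]
    linarith [Real.pi_gt_three]
  have hgm : Measurable fun θ => ‖g θ‖ₑ :=
    (continuous_iff_continuousAt.2 fun θ => (hg θ).continuousAt).enorm.measurable
  -- Average the oscillation bound over the circle, which has measure `2π ≥ 1`.
  have hav : volume I * ‖g θ₀‖ₑ ≤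
      volume I * ((∫⁻ t in I, ‖g t‖ₑ) + ∫⁻ t in I, ‖g' t‖ₑ) := by
    calc volume I * ‖g θ₀‖ₑ = ∫⁻ θ in I, ‖g θ₀‖ₑ := by
          rw [setLIntegral_const, mul_comm]
      _ ≤ ∫⁻ θ in I, (‖g θ‖ₑ + ∫⁻ t in I, ‖g' t‖ₑ) :=
          setLIntegral_mono' measurableSet_Ioo hosc
      _ = (∫⁻ θ in I, ‖g θ‖ₑ) + volume I * ∫⁻ t in I, ‖g' t‖ₑ := by
          rw [lintegral_add_left hgm, setLIntegral_const, mul_comm]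
      _ ≤ _ := by
          rw [mul_add]
          gcongr
          exact le_mul_of_one_le_left' h1v
  rw [ENNReal.mul_le_mul_iff_right (one_pos.trans_le h1v).ne'
    (by rw [hvol]; exact ENNReal.ofReal_ne_top)] at hav
  refine hav.trans ?_
  rw [lintegral_add_left hgm]
  gcongr with θ
  rw [← ofReal_norm, ← ofReal_norm, ← ENNReal.ofReal_mul hρ]
  refine ENNReal.ofReal_le_ofReal ((norm_inner_le_norm _ _).trans_eq ?_)
  rw [hTn, mul_comm]

/-- Selection of a good radius.  By Fatou's lemma in polar coordinates, on some circle of radius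
between `R / 2` and `R` the `W^{1,1}` norms over the circle, and hence the suprema, of infinitely
many of the functions `w n` are controlled by the limit of (bounds for) the norms over the disc. -/
theorem exists_radius_frequently_le {z : E 2} {R : ℝ} (hR : 0 < R) {w : ℕ → E 2 → ℝ}
    (hw : ∀ n, ContDiffOn ℝ 1 (w n) (Metric.ball z R)) {b : ℕ → ℝ≥0∞}
    {L : ℝ≥0∞} (hb : ∀ n, ∫⁻ x in Metric.ball z R,
      (‖w n x‖ₑ + ENNReal.ofReal R * ‖gradient (w n) x‖ₑ) ≤ b n) (hL : Tendsto b atTop (𝓝 L)) :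
    ∃ ρ ∈ Ioo (R / 2) R, ∀ M, ENNReal.ofReal (4 / R ^ 2) * L < M →
      ∃ᶠ n in atTop, ∀ x ∈ Metric.sphere z ρ, ‖w n x‖ₑ ≤ M := by
  let f : ℕ → E 2 → ℝ≥0∞ := fun n => (Metric.ball z R).indicator
    fun x => ‖w n x‖ₑ + ENNReal.ofReal R * ‖gradient (w n) x‖ₑ
  have hf : ∀ n, Measurable (f n) := fun n => by
    have hc : ContinuousOn (fun x => ‖w n x‖ₑ + ENNReal.ofReal R * ‖gradient (w n) x‖ₑ)
        (Metric.ball z R) :=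
      (hw n).continuousOn.enorm.add ((ENNReal.continuous_const_mul
        ENNReal.ofReal_ne_top).comp_continuousOn
          (continuousOn_gradient Metric.isOpen_ball (hw n)).enorm)
    classical
    rw [show f n = (Metric.ball z R).piecewise _ 0 from (piecewise_eq_indicator).symm]
    exact hc.measurable_piecewise continuousOn_const Metric.isOpen_ball.measurableSet
  let h : ℕ → ℝ → ℝ≥0∞ := fun n ρ => ∫⁻ θ in Ioo (-Real.pi) Real.pi, f n (circlePoint z ρ θ)
  have hh : ∀ n, Measurable (h n) := fun n =>
    ((hf n).comp (continuous_circlePoint z).measurable).lintegral_prod_right'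
  have hR2 : 0 < 2 / R := by positivity
  have hle : ∀ n, ∫⁻ ρ in Ioo (R / 2) R, h n ρ ≤ ENNReal.ofReal (2 / R) * b n := fun n => by
    refine le_trans ?_ (mul_le_mul_right (hb n) _)
    rw [← lintegral_indicator Metric.isOpen_ball.measurableSet, ← lintegral_circlePoint z (hf n),
      ← lintegral_const_mul' _ _ ENNReal.ofReal_ne_top]
    -- On the annulus the polar density `ρ` is at least `R / 2`.
    refine (setLIntegral_mono' measurableSet_Ioo (fun ρ hρ => ?_)).trans
      (lintegral_mono_set (fun ρ hρ => ?_ : Ioo (R / 2) R ⊆ Ioi 0))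
    · rw [← mul_assoc, ← ENNReal.ofReal_mul hR2.le]
      refine le_mul_of_one_le_left' (ENNReal.one_le_ofReal.2 ?_)
      rw [div_mul_eq_mul_div, one_le_div hR]
      linarith [hρ.1]
    · exact (half_pos hR).trans hρ.1
  have hfatou : ∫⁻ ρ in Ioo (R / 2) R, liminf (fun n => h n ρ) atTop ≤
      ENNReal.ofReal (2 / R) * L := by
    refine (lintegral_liminf_le hh).trans ?_
    have ht := ENNReal.Tendsto.const_mul (a := ENNReal.ofReal (2 / R)) hL
      (Or.inr ENNReal.ofReal_ne_top)
    rw [← ht.liminf_eq]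
    exact liminf_le_liminf (Eventually.of_forall hle)
  have hvol : volume (Ioo (R / 2) R) = ENNReal.ofReal (R / 2) := by
    rw [Real.volume_Ioo]; congr 1; ring
  obtain ⟨ρ, hρ, hρle⟩ := exists_le_setLAverage (μ := volume) (s := Ioo (R / 2) R)
    (f := fun ρ => liminf (fun n => h n ρ) atTop)
    (by rw [hvol]; exact (ENNReal.ofReal_pos.2 (half_pos hR)).ne')
    (by rw [hvol]; exact ENNReal.ofReal_ne_top) (Measurable.liminf hh).aemeasurable
  have hρ0 : 0 < ρ := (half_pos hR).trans hρ.1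
  refine ⟨ρ, hρ, fun M hM => ?_⟩
  have hlt : liminf (fun n => h n ρ) atTop < M := by
    refine (hρle.trans ?_).trans_lt hM
    rw [setLAverage_eq, hvol, ENNReal.div_eq_inv_mul, ← ENNReal.ofReal_inv_of_pos (half_pos hR)]
    refine (mul_le_mul_right hfatou _).trans_eq ?_
    rw [← mul_assoc, ← ENNReal.ofReal_mul (by positivity)]
    congr 2
    field_simp
    norm_num
  refine (frequently_lt_of_liminf_lt (by isBoundedDefault) hlt).mono fun n hn x hx => ?_
  have hsub : Metric.sphere z ρ ⊆ Metric.ball z R := fun y hy => by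
    rw [Metric.mem_ball, Metric.mem_sphere.1 hy]; exact hρ.2
  refine ((enorm_le_lintegral_circle Metric.isOpen_ball (hw n) hρ0.le hsub hx).trans
    (lintegral_mono fun θ => ?_)).trans hn.le
  dsimp only [f]
  rw [indicator_of_mem (hsub (dist_circlePoint z hρ0.le θ))]
  gcongr
  exact hρ.2.le

/-! ### The weighted Sobolev space -/

/-- The standing assumptions: `Ω` is open, `a` is a Caratheodory function, `μ ∈ L^1(Ω)` and
`λ⁻¹ ∈ L^{1/(p-1)}(Ω)` with `1 < p`. -/
structure IsAdmissible (Ω : Set (E d)) (p : ℝ) (a : E d → E d → E d) : Prop where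
  one_lt : 1 < p
  isOpen : IsOpen Ω
  caratheodory : IsCaratheodory Ω a
  lintegral_mu : ∫⁻ x in Ω, mu p a x < ∞
  lintegral_lam_inv : ∫⁻ x in Ω, (lam p a x)⁻¹ ^ (1 / (p - 1)) < ∞

namespace IsAdmissible

variable {Ω : Set (E d)} {p : ℝ} {a : E d → E d → E d}

theorem aemeasurable_lam (h : IsAdmissible Ω p a) :
    AEMeasurable (lam p a) (volume.restrict Ω) :=
  NonuniformElliptic.aemeasurable_lam h.caratheodory

theorem lam_ne_top [Nontrivial (E d)] (h : IsAdmissible Ω p a) :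
    ∀ᵐ x ∂(volume.restrict Ω), lam p a x ≠ ∞ := by
  have h1 : ∫⁻ x in Ω, lam p a x < ∞ :=
    (lintegral_mono fun x => lam_le_mu h.one_lt a x).trans_lt h.lintegral_mu
  filter_upwards [ae_lt_top' h.aemeasurable_lam h1.ne] with x hx using hx.ne

theorem lam_ne_zero (h : IsAdmissible Ω p a) : ∀ᵐ x ∂(volume.restrict Ω), lam p a x ≠ 0 := by
  have hp : 0 < 1 / (p - 1) := one_div_pos.2 (sub_pos.2 h.one_lt)
  filter_upwards [ae_lt_top' (h.aemeasurable_lam.inv.pow_const _) h.lintegral_lam_inv.ne]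
    with x hx h0
  rw [Pi.inv_apply, h0, ENNReal.inv_zero, ENNReal.top_rpow_of_pos hp] at hx
  exact lt_irrefl _ hx

theorem tendsto_lintegral_of_lam [Nontrivial (E d)] (h : IsAdmissible Ω p a)
    {F : ℕ → E d → ℝ≥0∞} (hF : ∀ n, AEMeasurable (F n) (volume.restrict Ω))
    (ht : Tendsto (fun n => ∫⁻ x in Ω, lam p a x * F n x ^ p) atTop (𝓝 0)) :
    Tendsto (fun n => ∫⁻ x in Ω, F n x) atTop (𝓝 0) :=
  tendsto_lintegral_of_weighted h.one_lt h.aemeasurable_lam h.lam_ne_top h.lam_ne_zero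
    h.lintegral_lam_inv hF ht

theorem lintegral_lt_top_of_lam [Nontrivial (E d)] (h : IsAdmissible Ω p a)
    {F : E d → ℝ≥0∞} (hF : AEMeasurable F (volume.restrict Ω))
    (ht : ∫⁻ x in Ω, lam p a x * F x ^ p < ∞) : ∫⁻ x in Ω, F x < ∞ := by
  have hp := h.one_lt
  refine (lintegral_le_weighted hp h.aemeasurable_lam h.lam_ne_top h.lam_ne_zero hF).trans_lt
    (ENNReal.mul_lt_top ?_ ?_)
  · exact ENNReal.rpow_lt_top_of_nonneg (by positivity) ht.ne
  · exact ENNReal.rpow_lt_top_of_nonneg (div_nonneg (by linarith) (by linarith))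
      h.lintegral_lam_inv.ne

end IsAdmissible

theorem lintegral_lam_le_energy {Ω : Set (E d)} {p : ℝ} (a : E d → E d → E d) (u : E d → ℝ)
    (G : E d → E d) : ∫⁻ x in Ω, lam p a x * ‖G x‖ₑ ^ p ≤ energy Ω p a u G :=
  lintegral_mono fun _ => le_self_add

theorem lintegral_mu_le_energy {Ω : Set (E d)} {p : ℝ} (a : E d → E d → E d) (u : E d → ℝ)
    (G : E d → E d) : ∫⁻ x in Ω, mu p a x * ‖u x‖ₑ ^ p ≤ energy Ω p a u G :=
  lintegral_mono fun _ => le_add_self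

/-- As `λ ≤ μ`, the energy also controls the function itself with the weight `λ`. -/
theorem lintegral_lam_le_energy' [Nontrivial (E d)] {Ω : Set (E d)} {p : ℝ} (hp : 1 < p)
    (a : E d → E d → E d) (u : E d → ℝ) (G : E d → E d) :
    ∫⁻ x in Ω, lam p a x * ‖u x‖ₑ ^ p ≤ energy Ω p a u G :=
  (lintegral_mono fun x => mul_le_mul_left (lam_le_mu hp a x) _).trans
    (lintegral_mu_le_energy a u G)

theorem lintegral_weighted_lt_top_of_sub {α F : Type*} [MeasurableSpace α] [NormedAddCommGroup F]
    {ν : Measure α} {p : ℝ} (hp : 1 ≤ p) {l : α → ℝ≥0∞} (hl : AEMeasurable l ν) {f g : α → F}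
    (hf : AEStronglyMeasurable f ν) (h1 : ∫⁻ x, l x * ‖f x‖ₑ ^ p ∂ν < ∞)
    (h2 : ∫⁻ x, l x * ‖f x - g x‖ₑ ^ p ∂ν < ∞) : ∫⁻ x, l x * ‖g x‖ₑ ^ p ∂ν < ∞ := by
  have hm : AEMeasurable (fun x => l x * ‖f x‖ₑ ^ p) ν := hl.mul (hf.enorm.pow_const _)
  have hc : (2 : ℝ≥0∞) ^ (p - 1) < ∞ := ENNReal.rpow_lt_top_of_nonneg (by linarith) (by simp)
  calc ∫⁻ x, l x * ‖g x‖ₑ ^ p ∂ν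
      ≤ ∫⁻ x, 2 ^ (p - 1) * (l x * ‖f x‖ₑ ^ p + l x * ‖f x - g x‖ₑ ^ p) ∂ν := by
        refine lintegral_mono fun x => ?_
        rw [← mul_add, mul_left_comm]
        gcongr
        refine le_trans ?_ (ENNReal.rpow_add_le_mul_rpow_add_rpow _ _ hp)
        gcongr
        have h := enorm_sub_le (a := f x) (b := f x - g x)
        rwa [sub_sub_cancel] at h
    _ < ∞ := by
        rw [lintegral_const_mul' _ _ hc.ne, lintegral_add_left' hm]
        exact ENNReal.mul_lt_top hc (ENNReal.add_lt_top.2 ⟨h1, h2⟩)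

/-- The data of an approximation of `(u, G)` in `H^{1,p}(Ω,a)` by `C^1` functions, which converges
also in `W^{1,1}(Ω)` and almost everywhere. -/
structure EnergyApprox (Ω : Set (E d)) (p : ℝ) (a : E d → E d → E d) (φ : ℕ → E d → ℝ)
    (u : E d → ℝ) (G : E d → E d) : Prop extends W11Approx Ω φ u G where
  energy_lt_top : ∀ n, energy Ω p a (φ n) (gradient (φ n)) < ∞
  tendsto_energy : Tendsto (fun n => energy Ω p a (fun x => φ n x - u x)
    (fun x => gradient (φ n) x - G x)) atTop (𝓝 0)
  lintegral_lam_grad : ∫⁻ x in Ω, lam p a x * ‖G x‖ₑ ^ p < ∞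

theorem EnergyApprox.subseq {Ω : Set (E d)} {p : ℝ} {a : E d → E d → E d} {φ : ℕ → E d → ℝ}
    {u : E d → ℝ} {G : E d → E d} (h : EnergyApprox Ω p a φ u G) {s : ℕ → ℕ}
    (hs : StrictMono s) : EnergyApprox Ω p a (fun n => φ (s n)) u G where
  contDiffOn n := h.contDiffOn (s n)
  integrableOn := h.integrableOn
  integrableOn_grad := h.integrableOn_grad
  tendsto := h.tendsto.comp hs.tendsto_atTop
  tendsto_grad := h.tendsto_grad.comp hs.tendsto_atTop
  tendsto_ae := h.tendsto_ae.mono fun _ hx => hx.comp hs.tendsto_atTop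
  energy_lt_top n := h.energy_lt_top (s n)
  tendsto_energy := h.tendsto_energy.comp hs.tendsto_atTop
  lintegral_lam_grad := h.lintegral_lam_grad

theorem MemH.exists_energyApprox [Nontrivial (E d)] {Ω : Set (E d)} {p : ℝ} {a : E d → E d → E d}
    (ha : IsAdmissible Ω p a) {u : E d → ℝ} {G : E d → E d} (hu : MemH Ω p a u G) :
    ∃ φ, EnergyApprox Ω p a φ u G := by
  obtain ⟨hum, hGm, φ, hφ, ht⟩ := hu
  have hp := ha.one_lt
  have hφm : ∀ n, AEStronglyMeasurable (φ n) (volume.restrict Ω) := fun n =>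
    (hφ n).1.continuousOn.aestronglyMeasurable ha.isOpen.measurableSet
  have hgm : ∀ n, AEStronglyMeasurable (gradient (φ n)) (volume.restrict Ω) := fun n =>
    aestronglyMeasurable_gradient ha.isOpen (hφ n).1
  have hu1 : Tendsto (fun n => ∫⁻ x in Ω, ‖φ n x - u x‖ₑ) atTop (𝓝 0) :=
    ha.tendsto_lintegral_of_lam (fun n => ((hφm n).sub hum).enorm)
      (tendsto_of_tendsto_of_tendsto_of_le_of_le tendsto_const_nhds ht (fun _ => zero_le)
        fun n => lintegral_lam_le_energy' hp a _ _)
  have hG1 : Tendsto (fun n => ∫⁻ x in Ω, ‖gradient (φ n) x - G x‖ₑ) atTop (𝓝 0) :=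
    ha.tendsto_lintegral_of_lam (fun n => ((hgm n).sub hGm).enorm)
      (tendsto_of_tendsto_of_tendsto_of_le_of_le tendsto_const_nhds ht (fun _ => zero_le)
        fun n => lintegral_lam_le_energy a (fun x => φ n x - u x) _)
  obtain ⟨N, hN⟩ := (ht.eventually_lt_const one_pos).exists
  have hN' := hN.trans ENNReal.one_lt_top
  have hGl : ∫⁻ x in Ω, lam p a x * ‖G x‖ₑ ^ p < ∞ :=
    lintegral_weighted_lt_top_of_sub hp.le ha.aemeasurable_lam (hgm N)
      ((lintegral_lam_le_energy a _ _).trans_lt (hφ N).2)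
      ((lintegral_lam_le_energy a (fun x => φ N x - u x) _).trans_lt hN')
  have hul : ∫⁻ x in Ω, lam p a x * ‖u x‖ₑ ^ p < ∞ :=
    lintegral_weighted_lt_top_of_sub hp.le ha.aemeasurable_lam (hφm N)
      ((lintegral_lam_le_energy' hp a _ _).trans_lt (hφ N).2)
      ((lintegral_lam_le_energy' hp a (fun x => φ N x - u x) _).trans_lt hN')
  obtain ⟨s, hs, hae⟩ := exists_subseq_tendsto_ae hφm hum hu1
  exact ⟨fun n => φ (s n), ⟨⟨fun n => (hφ (s n)).1,
    ⟨hum, ha.lintegral_lt_top_of_lam hum.enorm hul⟩,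
    ⟨hGm, ha.lintegral_lt_top_of_lam hGm.enorm hGl⟩,
    hu1.comp hs.tendsto_atTop, hG1.comp hs.tendsto_atTop, hae⟩,
    fun n => (hφ (s n)).2, ht.comp hs.tendsto_atTop, hGl⟩⟩

/-! ### Cutting off inside a ball -/

/-- A `C^1` function on a ball which vanishes near the boundary sphere is extended by zero. -/
theorem contDiff_indicator_ball {z : E d} {ρ : ℝ} {f : E d → ℝ}
    (hf : ContDiffOn ℝ 1 f (Metric.ball z ρ))
    (h0 : ∀ x ∈ Metric.sphere z ρ, f =ᶠ[𝓝 x] 0) :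
    ContDiff ℝ 1 ((Metric.ball z ρ).indicator f) ∧
      gradient ((Metric.ball z ρ).indicator f) = (Metric.ball z ρ).indicator (gradient f) := by
  have hin : ∀ x ∈ Metric.ball z ρ, (Metric.ball z ρ).indicator f =ᶠ[𝓝 x] f := fun x hx => by
    filter_upwards [Metric.isOpen_ball.mem_nhds hx] with y hy using indicator_of_mem hy _
  have hout : ∀ x ∉ Metric.ball z ρ, (Metric.ball z ρ).indicator f =ᶠ[𝓝 x] fun _ => 0 := by
    intro x hx
    by_cases hs : x ∈ Metric.sphere z ρ
    · filter_upwards [h0 x hs] with y hy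
      by_cases hyB : y ∈ Metric.ball z ρ
      · rw [indicator_of_mem hyB, hy, Pi.zero_apply]
      · exact indicator_of_notMem hyB _
    · have hc : x ∈ (Metric.closedBall z ρ)ᶜ := fun hxc => by
        rw [← Metric.ball_union_sphere] at hxc
        exact hxc.elim hx hs
      filter_upwards [Metric.isClosed_closedBall.isOpen_compl.mem_nhds hc] with y hy
      exact indicator_of_notMem (fun hyB => hy (Metric.ball_subset_closedBall hyB)) _
  refine ⟨contDiff_iff_contDiffAt.2 fun x => ?_, funext fun x => ?_⟩
  · by_cases hx : x ∈ Metric.ball z ρ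
    · exact (hf.contDiffAt (Metric.isOpen_ball.mem_nhds hx)).congr_of_eventuallyEq (hin x hx)
    · exact contDiffAt_const.congr_of_eventuallyEq (hout x hx)
  · by_cases hx : x ∈ Metric.ball z ρ
    · rw [indicator_of_mem hx, (hin x hx).gradient_eq]
    · rw [indicator_of_notMem hx, (hout x hx).gradient_eq, gradient_fun_const]

theorem mem_C1c_indicator_ball {Ω : Set (E d)} {z : E d} {ρ : ℝ} {f : E d → ℝ}
    (hf : ContDiff ℝ 1 ((Metric.ball z ρ).indicator f)) (hΩ : Metric.closedBall z ρ ⊆ Ω) :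
    (Metric.ball z ρ).indicator f ∈ C1c Ω := by
  have hs : tsupport ((Metric.ball z ρ).indicator f) ⊆ Metric.closedBall z ρ :=
    closure_minimal (support_indicator_subset.trans Metric.ball_subset_closedBall)
      Metric.isClosed_closedBall
  exact ⟨hf, (isCompact_closedBall z ρ).of_isClosed_subset (isClosed_tsupport _) hs, hs.trans hΩ⟩

/-! ### The maximum principle -/

/-- Compactly supported `C^1` functions in the plane whose gradients tend to zero in `L^1` can only
have the almost everywhere limit zero, by the Gagliardo-Nirenberg-Sobolev inequality and Fatou's
lemma. -/
theorem ae_eq_zero_of_tendsto_gradient {Ω : Set (E 2)} {ψ : ℕ → E 2 → ℝ} {w : E 2 → ℝ}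
    (hψ : ∀ n, ContDiff ℝ 1 (ψ n)) (hc : ∀ n, HasCompactSupport (ψ n))
    (h : Tendsto (fun n => ∫⁻ x, ‖gradient (ψ n) x‖ₑ) atTop (𝓝 0))
    (hae : ∀ᵐ x ∂(volume.restrict Ω), Tendsto (fun n => ψ n x) atTop (𝓝 (w x))) :
    ∀ᵐ x ∂(volume.restrict Ω), w x = 0 := by
  have hpq : Real.HolderConjugate (Module.finrank ℝ (E 2)) 2 := by
    rw [finrank_euclideanSpace_fin]
    exact_mod_cast Real.HolderConjugate.two_two
  have h2 := ENNReal.Tendsto.const_mul (a := lintegralPowLePowLIntegralFDerivConst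
    (volume : Measure (E 2)) 2) (h.ennrpow_const 2) (Or.inr ENNReal.coe_ne_top)
  rw [ENNReal.zero_rpow_of_pos two_pos, mul_zero] at h2
  have h3 : Tendsto (fun n => ∫⁻ x in Ω, ‖ψ n x‖ₑ ^ (2 : ℝ)) atTop (𝓝 0) := by
    refine tendsto_of_tendsto_of_tendsto_of_le_of_le tendsto_const_nhds h2 (fun _ => zero_le)
      fun n => (setLIntegral_le_lintegral _ _).trans
        ((lintegral_pow_le_pow_lintegral_fderiv volume (hψ n) (hc n) hpq).trans_eq ?_)
    simp only [← ofReal_norm, norm_gradient]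
  have hm : ∀ n, Measurable fun x => ‖ψ n x‖ₑ ^ (2 : ℝ) := fun n =>
    (hψ n).continuous.enorm.measurable.pow_const _
  have h4 : ∫⁻ x in Ω, liminf (fun n => ‖ψ n x‖ₑ ^ (2 : ℝ)) atTop = 0 := by
    refine le_antisymm ((lintegral_liminf_le hm).trans ?_) zero_le
    rw [h3.liminf_eq]
  rw [lintegral_eq_zero_iff (Measurable.liminf hm)] at h4
  filter_upwards [h4, hae] with x hx hxt
  rw [(hxt.enorm.ennrpow_const 2).liminf_eq] at hx
  simpa using hx

/-- The maximum principle: if the approximating functions are below `M ≥ 0` on a circle, then the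
subsolution is below `M` in the disc.  The test function is `η(u)` in the disc and zero outside,
where `η = softPos 1 (· - M)`: it is the limit of the `C^1_c` functions `η(φ_n)`, which vanish near
the circle.  Testing gives `η'(u) λ |G|^p = 0`, so the test function has zero gradient. -/
theorem EnergyApprox.ae_le_of_sphere {Ω : Set (E 2)} {p : ℝ} {a : E 2 → E 2 → E 2}
    (ha : IsAdmissible Ω p a) {φ : ℕ → E 2 → ℝ} {u : E 2 → ℝ} {G : E 2 → E 2}
    (h : EnergyApprox Ω p a φ u G)
    (hsub : ∀ (ψ : E 2 → ℝ) (Ψ : E 2 → E 2), MemH0 Ω p a ψ Ψ →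
      (∀ᵐ x ∂(volume.restrict Ω), 0 ≤ ψ x) →
        IntegralNonpos (volume.restrict Ω) (fun x => inner ℝ (a x (G x)) (Ψ x)))
    {z : E 2} {ρ M : ℝ} (hΩ : Metric.closedBall z ρ ⊆ Ω) (hM : 0 ≤ M)
    (hφM : ∀ n, ∀ x ∈ Metric.sphere z ρ, φ n x < M) :
    ∀ᵐ x ∂(volume.restrict (Metric.ball z ρ)), u x ≤ M := by
  have hp := ha.one_lt
  have hp0 : 0 < p := by linarith
  set B := Metric.ball z ρ with hB
  have hBm : MeasurableSet B := Metric.isOpen_ball.measurableSet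
  have hBΩ : B ⊆ Ω := Metric.ball_subset_closedBall.trans hΩ
  have hΩm := ha.isOpen.measurableSet
  let η : ℝ → ℝ := fun t => softPos 1 (t - M)
  let η' : ℝ → ℝ := fun t => softPosDeriv 1 (t - M)
  have hη : ∀ t, HasDerivAt η (η' t) t := fun t =>
    (hasDerivAt_softPos one_pos (t - M)).comp_sub_const t M
  have hη'c : Continuous η' :=
    (continuous_softPosDeriv one_pos).comp (continuous_id.sub continuous_const)
  have hη1 : ∀ t, |η' t| ≤ 1 := fun t => abs_softPosDeriv_le_one one_pos _
  have hη0 : ∀ t, |η t| ≤ |t| := fun t => by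
    rw [abs_of_nonneg (softPos_nonneg _ _)]
    exact (softPos_le one_pos _).trans
      (max_le (by linarith [le_abs_self t]) (abs_nonneg t))
  have hc := h.toW11Approx.comp ha.isOpen hη hη'c hη1 hη0
  have hgrad : ∀ n, ∀ x ∈ Ω, gradient (fun y => η (φ n y)) x = η' (φ n x) • gradient (φ n) x :=
    fun n x hx => gradient_comp_left (hη _)
      (((h.contDiffOn n).differentiableOn one_ne_zero).differentiableAt (ha.isOpen.mem_nhds hx))
  let ψ : ℕ → E 2 → ℝ := fun n => B.indicator fun x => η (φ n x)
  let w : E 2 → ℝ := B.indicator fun x => η (u x)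
  let W : E 2 → E 2 := B.indicator fun x => η' (u x) • G x
  have hψ : ∀ n, ContDiff ℝ 1 (ψ n) ∧
      gradient (ψ n) = B.indicator (gradient fun x => η (φ n x)) := fun n => by
    refine contDiff_indicator_ball ((hc.contDiffOn n).mono hBΩ) fun x hx => ?_
    have hxΩ : x ∈ Ω := hΩ (Metric.sphere_subset_closedBall hx)
    -- By continuity `φ n < M` in a neighbourhood of the circle, and `η` vanishes below `M`.
    filter_upwards [((h.contDiffOn n).continuousOn.continuousAt
      (ha.isOpen.mem_nhds hxΩ)).eventually_lt_const (hφM n x hx)] with y hy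
    exact softPos_of_nonpos one_pos (by linarith)
  have hψc : ∀ n, ψ n ∈ C1c Ω := fun n => mem_C1c_indicator_ball (hψ n).1 hΩ
  -- The cut-off functions have finite energy because `|η t| ≤ |t|` and `|η'| ≤ 1`.
  have hψe : ∀ n, energy Ω p a (ψ n) (gradient (ψ n)) < ∞ := fun n => by
    refine (setLIntegral_mono' hΩm fun x hx => ?_).trans_lt (h.energy_lt_top n)
    rw [(hψ n).2]
    dsimp only [ψ]
    by_cases hxB : x ∈ B
    · rw [indicator_of_mem hxB, indicator_of_mem hxB, hgrad n x hx]
      gcongr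
      · rw [enorm_smul]
        refine mul_le_of_le_one_left' ?_
        rw [← ofReal_norm, Real.norm_eq_abs]
        exact ENNReal.ofReal_le_one.2 (hη1 _)
      · rw [← ofReal_norm, ← ofReal_norm]
        exact ENNReal.ofReal_le_ofReal (hη0 _)
    · rw [indicator_of_notMem hxB, indicator_of_notMem hxB]
      simp [hp0]
  have hum := h.integrableOn.aestronglyMeasurable
  have hGm := h.integrableOn_grad.aestronglyMeasurable
  have hφm : ∀ n, AEStronglyMeasurable (φ n) (volume.restrict Ω) := fun n =>
    (h.contDiffOn n).continuousOn.aestronglyMeasurable hΩm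
  have hgm : ∀ n, AEStronglyMeasurable (gradient (φ n)) (volume.restrict Ω) := fun n =>
    aestronglyMeasurable_gradient ha.isOpen (h.contDiffOn n)
  have hchain := tendsto_lintegral_smul_comp hp.le ha.aemeasurable_lam hη'c hη1 hφm hum hgm hGm
    h.tendsto_ae h.lintegral_lam_grad
    (tendsto_of_tendsto_of_tendsto_of_le_of_le tendsto_const_nhds h.tendsto_energy
      (fun _ => zero_le) fun n => lintegral_lam_le_energy a (fun x => φ n x - u x) _)
  -- For the zeroth order term it suffices that `η` is Lipschitz with constant `1`, so that no
  -- measurability of `μ` is needed.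
  have hconv : Tendsto (fun n => energy Ω p a (fun x => ψ n x - w x)
      (fun x => gradient (ψ n) x - W x)) atTop (𝓝 0) := by
    have hs := hchain.add h.tendsto_energy
    rw [add_zero] at hs
    refine tendsto_of_tendsto_of_tendsto_of_le_of_le tendsto_const_nhds hs (fun _ => zero_le)
      fun n => ?_
    refine le_trans ?_ (add_le_add_right (lintegral_mu_le_energy a _ _) _)
    have hm : AEMeasurable (fun x => lam p a x *
        ‖η' (φ n x) • gradient (φ n) x - η' (u x) • G x‖ₑ ^ p) (volume.restrict Ω) :=
      ha.aemeasurable_lam.mul ((((hη'c.comp_aestronglyMeasurable (hφm n)).smul (hgm n)).sub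
        ((hη'c.comp_aestronglyMeasurable hum).smul hGm)).enorm.pow_const _)
    rw [← lintegral_add_left' hm]
    refine setLIntegral_mono' hΩm fun x hx => ?_
    rw [(hψ n).2]
    dsimp only [ψ, w, W]
    by_cases hxB : x ∈ B
    · simp only [indicator_of_mem hxB]
      rw [hgrad n x hx]
      gcongr
      exact enorm_sub_le_of_hasDerivAt hη hη1 _ _
    · simp [indicator_of_notMem hxB, hp0]
  have hmem : MemH0 Ω p a w W :=
    ⟨hc.integrableOn.aestronglyMeasurable.indicator hBm,
      hc.integrableOn_grad.aestronglyMeasurable.indicator hBm, ψ,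
      fun n => ⟨hψc n, hψe n⟩, hconv⟩
  have htest := hsub w W hmem
    (Eventually.of_forall fun x => indicator_nonneg (fun y _ => softPos_nonneg _ _) x)
  -- The integrand of the test is `c a(x,G)·G` with `c ≥ 0`, hence nonnegative, so both sides of
  -- the inequality `∫ f⁺ ≤ ∫ f⁻` vanish.
  let c : E 2 → ℝ := B.indicator fun x => η' (u x)
  have hc0 : ∀ x, 0 ≤ c x := fun x => indicator_nonneg (fun y _ => softPosDeriv_nonneg _ _) x
  have hcW : ∀ x, W x = c x • G x := fun x => by
    by_cases hxB : x ∈ B <;> simp [W, c, hxB]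
  have hneg : ∫⁻ x in Ω, ENNReal.ofReal (-inner ℝ (a x (G x)) (W x)) = 0 := by
    rw [← lintegral_zero (μ := volume.restrict Ω)]
    refine lintegral_congr_ae ?_
    filter_upwards [ha.lam_ne_zero] with x hx
    rw [hcW, inner_smul_right, ENNReal.ofReal_eq_zero, neg_nonpos]
    refine mul_nonneg (hc0 x) ?_
    by_contra! hlt
    have h1 := lam_mul_le hp a x (G x)
    rw [ENNReal.ofReal_of_nonpos hlt.le, nonpos_iff_eq_zero, mul_eq_zero, or_iff_right hx,
      ENNReal.rpow_eq_zero_iff_of_pos hp0, enorm_eq_zero] at h1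
    rw [h1, inner_zero_right] at hlt
    exact lt_irrefl _ hlt
  have hpos : ∫⁻ x in Ω, ENNReal.ofReal (c x) * (lam p a x * ‖G x‖ₑ ^ p) = 0 := by
    refine le_antisymm ?_ zero_le
    rw [← hneg]
    refine le_trans (lintegral_mono fun x => ?_) htest
    dsimp only
    rw [hcW, inner_smul_right, ENNReal.ofReal_mul (hc0 x)]
    gcongr
    exact lam_mul_le hp a x (G x)
  have hcm : AEStronglyMeasurable c (volume.restrict Ω) :=
    (hη'c.comp_aestronglyMeasurable hum).indicator hBm
  have hm : AEMeasurable (fun x => ENNReal.ofReal (c x) * (lam p a x * ‖G x‖ₑ ^ p))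
      (volume.restrict Ω) :=
    hcm.aemeasurable.ennreal_ofReal.mul (ha.aemeasurable_lam.mul (hGm.enorm.pow_const _))
  rw [lintegral_eq_zero_iff' hm] at hpos
  have hW0 : ∀ᵐ x ∂(volume.restrict Ω), W x = 0 := by
    filter_upwards [hpos, ha.lam_ne_zero] with x hx hx0
    rw [hcW]
    simp only [Pi.zero_apply, mul_eq_zero, hx0, false_or, ENNReal.ofReal_eq_zero,
      ENNReal.rpow_eq_zero_iff_of_pos hp0, enorm_eq_zero] at hx
    rcases hx with hx | hx
    · rw [le_antisymm hx (hc0 x), zero_smul]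
    · rw [hx, smul_zero]
  -- As the limit of the gradients is zero in `L^p(λ)`, it is zero in `L^1` by Hölder's inequality.
  have hψ0 : Tendsto (fun n => ∫⁻ x, ‖gradient (ψ n) x‖ₑ) atTop (𝓝 0) := by
    have hgψ : ∀ n, Continuous (gradient (ψ n)) := fun n => by
      rw [← continuousOn_univ]
      exact continuousOn_gradient isOpen_univ (hψ n).1.contDiffOn
    have ht := ha.tendsto_lintegral_of_lam (F := fun n x => ‖gradient (ψ n) x‖ₑ)
      (fun n => (hgψ n).enorm.aemeasurable) ?_
    · refine ht.congr fun n => setLIntegral_eq_of_support_subset fun x hx => ?_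
      by_contra hxΩ
      refine hx ?_
      dsimp only
      rw [(hψ n).2, indicator_of_notMem fun hxB => hxΩ (hBΩ hxB), enorm_zero]
    · refine tendsto_of_tendsto_of_tendsto_of_le_of_le tendsto_const_nhds hconv
        (fun _ => zero_le) fun n => le_trans (le_of_eq (lintegral_congr_ae ?_))
          (lintegral_lam_le_energy a (fun x => ψ n x - w x) _)
      filter_upwards [hW0] with x hx
      rw [hx, sub_zero]
  have hae : ∀ᵐ x ∂(volume.restrict Ω), Tendsto (fun n => ψ n x) atTop (𝓝 (w x)) := by
    filter_upwards [hc.tendsto_ae] with x hx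
    by_cases hxB : x ∈ B
    · simpa [ψ, w, hxB] using hx
    · simp [ψ, w, hxB]
  have hw0 := ae_restrict_of_ae_restrict_of_subset hBΩ
    (ae_eq_zero_of_tendsto_gradient (fun n => (hψ n).1) (fun n => (hψc n).2.1) hψ0 hae)
  filter_upwards [hw0, ae_restrict_mem hBm] with x hx hxB
  by_contra! hlt
  have : 0 < softPos 1 (u x - M) := softPos_pos 1 (by linarith)
  simp only [w, indicator_of_mem hxB] at hx
  exact this.ne' hx

/-! ### The local bound -/

theorem lintegral_enorm_le_add_sub {α F : Type*} [MeasurableSpace α] [NormedAddCommGroup F]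
    {ν : Measure α} {f g : α → F} (hg : AEStronglyMeasurable g ν) :
    ∫⁻ x, ‖f x‖ₑ ∂ν ≤ ∫⁻ x, ‖g x‖ₑ ∂ν + ∫⁻ x, ‖f x - g x‖ₑ ∂ν := by
  rw [← lintegral_add_left' hg.enorm]
  refine lintegral_mono fun x => ?_
  simpa using enorm_add_le (g x) (f x - g x)

/-- In `scaledW11Norm` the gradient term stands under the first integral sign, so that it carries
the factor `|B_r| r⁻² = π`. -/
theorem scaledW11Norm_eq {z : E 2} {r : ℝ} (hr : 0 < r) {v : E 2 → ℝ}
    (hv : IntegrableOn v (Metric.ball z r)) (V : E 2 → E 2) :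
    scaledW11Norm z r v V = (r ^ 2)⁻¹ * (∫ x in Metric.ball z r, |v x|) +
      Real.pi * (r⁻¹ * ∫ x in Metric.ball z r, ‖V x‖) := by
  have h1 : r ^ (-((2 : ℕ) : ℤ)) = (r ^ 2)⁻¹ := by rw [zpow_neg, zpow_natCast]
  have h2 : r ^ (1 - ((2 : ℕ) : ℤ)) = r⁻¹ := by norm_num
  have hvol : volume.real (Metric.ball z r) = r ^ 2 * Real.pi := by
    rw [Measure.real, EuclideanSpace.volume_ball_fin_two, ENNReal.toReal_mul, ENNReal.toReal_pow,
      ENNReal.toReal_ofReal hr.le, ENNReal.toReal_ofReal Real.pi_pos.le]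
  have hfin : IntegrableOn (fun _ : E 2 => r ^ (1 - ((2 : ℕ) : ℤ)) *
      ∫ x in Metric.ball z r, ‖V x‖) (Metric.ball z r) :=
    integrableOn_const measure_ball_lt_top.ne
  rw [scaledW11Norm, integral_add hv.abs hfin, setIntegral_const, hvol, h1, h2,
    smul_eq_mul]
  field_simp

theorem scaledW11Norm_nonneg (z : E 2) {r : ℝ} (hr : 0 < r) (v : E 2 → ℝ) (V : E 2 → E 2) :
    0 ≤ scaledW11Norm z r v V := by
  unfold scaledW11Norm
  positivity

/-- The circle on which infinitely many approximating functions are bounded: the truncations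
`softPos ε (φ n)` are controlled by the limiting norm over the disc, and they differ from the
positive part of `φ n` by at most `ε`. -/
theorem W11Approx.exists_radius {z : E 2} {R : ℝ} (hR : 0 < R) {φ : ℕ → E 2 → ℝ} {u : E 2 → ℝ}
    {G : E 2 → E 2} (h : W11Approx (Metric.ball z R) φ u G) {ε : ℝ} (hε : 0 < ε) :
    ∃ ρ ∈ Ioo (R / 2) R, ∃ᶠ n in atTop, ∀ x ∈ Metric.sphere z ρ,
      φ n x < 4 * scaledW11Norm z R (fun x => max (u x) 0)
        (fun x => (Ioi (0 : ℝ)).indicator (1 : ℝ → ℝ) (u x) • G x) + 3 * ε := by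
  set B := Metric.ball z R with hB
  set V : E 2 → E 2 := fun x => (Ioi (0 : ℝ)).indicator (1 : ℝ → ℝ) (u x) • G x with hV
  set N := scaledW11Norm z R (fun x => max (u x) 0) V with hN
  have hw := h.truncate Metric.isOpen_ball hε
  obtain ⟨hu1, hV1, -⟩ := h.memW11_max Metric.isOpen_ball
  have hN0 : 0 ≤ N := scaledW11Norm_nonneg z hR _ _
  -- `A` is the limit of the norms of the truncations over the disc.
  let A : ℝ≥0∞ := (∫⁻ x in B, ‖softPos ε (u x)‖ₑ) +
    ENNReal.ofReal R * ∫⁻ x in B, ‖softPosDeriv ε (u x) • G x‖ₑ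
  have hA : A ≤ ENNReal.ofReal (R ^ 2 * N) := by
    have e : (∫ x in B, ‖max (u x) 0‖) + R * ∫ x in B, ‖V x‖ ≤ R ^ 2 * N := by
      have h1 : R ^ 2 * N = (∫ x in B, |max (u x) 0|) +
          Real.pi * (R * ∫ x in B, ‖V x‖) := by
        rw [hN, scaledW11Norm_eq hR hu1, ← hB]
        field_simp
      have h2 : 0 ≤ R * ∫ x in B, ‖V x‖ := by positivity
      rw [h1]
      simp only [Real.norm_eq_abs]
      have h3 := le_mul_of_one_le_left h2 (by linarith [Real.pi_gt_three] : 1 ≤ Real.pi)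
      linarith
    refine le_trans ?_ (ENNReal.ofReal_le_ofReal e)
    rw [ENNReal.ofReal_add (by positivity) (by positivity), ENNReal.ofReal_mul hR.le,
      ofReal_integral_norm_eq_lintegral_enorm hu1, ofReal_integral_norm_eq_lintegral_enorm hV1]
    dsimp only [A]
    gcongr with x x
    · rw [← ofReal_norm, ← ofReal_norm, Real.norm_eq_abs, Real.norm_eq_abs,
        abs_of_nonneg (softPos_nonneg _ _), abs_of_nonneg (le_max_right _ _)]
      exact ENNReal.ofReal_le_ofReal (softPos_le hε _)
    · rw [← ofReal_norm, ← ofReal_norm]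
      refine ENNReal.ofReal_le_ofReal ?_
      by_cases hx : 0 < u x
      · simp only [mem_Ioi, hx, indicator_of_mem, Pi.one_apply, one_smul, norm_smul]
        exact mul_le_of_le_one_left (norm_nonneg _) (abs_softPosDeriv_le_one hε _)
      · simp [softPosDeriv_of_nonpos _ (not_lt.1 hx)]
  have hlim : Tendsto (fun n => A + ((∫⁻ x in B, ‖softPos ε (φ n x) - softPos ε (u x)‖ₑ) +
      ENNReal.ofReal R * ∫⁻ x in B, ‖gradient (fun y => softPos ε (φ n y)) x -
        softPosDeriv ε (u x) • G x‖ₑ)) atTop (𝓝 A) := by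
    have t := hw.tendsto.add (ENNReal.Tendsto.const_mul (a := ENNReal.ofReal R) hw.tendsto_grad
      (Or.inr ENNReal.ofReal_ne_top))
    rw [mul_zero, add_zero] at t
    simpa using t.const_add A
  have hb : ∀ n, ∫⁻ x in B, (‖softPos ε (φ n x)‖ₑ +
      ENNReal.ofReal R * ‖gradient (fun y => softPos ε (φ n y)) x‖ₑ) ≤
      A + ((∫⁻ x in B, ‖softPos ε (φ n x) - softPos ε (u x)‖ₑ) +
        ENNReal.ofReal R * ∫⁻ x in B, ‖gradient (fun y => softPos ε (φ n y)) x -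
          softPosDeriv ε (u x) • G x‖ₑ) := fun n => by
    have hm : AEMeasurable (fun x => ‖softPos ε (φ n x)‖ₑ) (volume.restrict B) :=
      ((hw.contDiffOn n).continuousOn.aestronglyMeasurable
        Metric.isOpen_ball.measurableSet).enorm
    rw [lintegral_add_left' hm, lintegral_const_mul' _ _ ENNReal.ofReal_ne_top]
    refine (add_le_add
      (lintegral_enorm_le_add_sub hw.integrableOn.aestronglyMeasurable)
      (mul_le_mul_right
        (lintegral_enorm_le_add_sub hw.integrableOn_grad.aestronglyMeasurable) _)).trans_eq ?_
    rw [mul_add]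
    exact add_add_add_comm _ _ _ _
  obtain ⟨ρ, hρ, hfr⟩ := exists_radius_frequently_le hR hw.contDiffOn hb hlim
  refine ⟨ρ, hρ, (hfr (ENNReal.ofReal (4 * N + ε)) ?_).mono fun n hn x hx => ?_⟩
  · calc ENNReal.ofReal (4 / R ^ 2) * A
        ≤ ENNReal.ofReal (4 / R ^ 2) * ENNReal.ofReal (R ^ 2 * N) := by gcongr
      _ = ENNReal.ofReal (4 * N) := by
          rw [← ENNReal.ofReal_mul (by positivity)]
          congr 1
          field_simp
      _ < _ := (ENNReal.ofReal_lt_ofReal_iff (by positivity)).2 (by linarith)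
  · have h1 := hn x hx
    rw [← ofReal_norm, ENNReal.ofReal_le_ofReal_iff (by positivity), Real.norm_eq_abs] at h1
    have h2 := max_sub_le_softPos ε (φ n x)
    linarith [le_abs_self (softPos ε (φ n x)), le_max_left (φ n x) 0]

end NonuniformElliptic

theorem mainTheorem4 (p : ℝ) (hp : 1 < p) :
    ∃ c : ℝ, 1 ≤ c ∧
      ∀ (Ω : Set (NonuniformElliptic.E 2)), IsOpen Ω →
      ∀ (a : NonuniformElliptic.E 2 → NonuniformElliptic.E 2 → NonuniformElliptic.E 2),
        NonuniformElliptic.IsCaratheodory Ω a →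
        (∀ᵐ x ∂(volume.restrict Ω), a x 0 = 0) →
        (∫⁻ x in Ω, NonuniformElliptic.mu p a x) < ∞ →
        (∫⁻ x in Ω, (NonuniformElliptic.lam p a x)⁻¹ ^ (1 / (p - 1))) < ∞ →
      ∀ (u : NonuniformElliptic.E 2 → ℝ), NonuniformElliptic.IsWeakSubsolution Ω p a u →
      ∀ (z : NonuniformElliptic.E 2) (R : ℝ), 0 < R → Metric.ball z R ⊆ Ω →
        ∃ V : NonuniformElliptic.E 2 → NonuniformElliptic.E 2,
          NonuniformElliptic.MemW11 (Metric.ball z R) (fun x => max (u x) 0) V ∧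
          ∀ᵐ x ∂(volume.restrict (Metric.ball z (R / 2))),
            u x ≤ c * NonuniformElliptic.scaledW11Norm z R (fun x => max (u x) 0) V := by
  refine ⟨4, by norm_num, fun Ω hΩ a ha _ hmu hlam u ⟨G, hu, hsub⟩ z R hR hball => ?_⟩
  have had : NonuniformElliptic.IsAdmissible Ω p a := ⟨hp, hΩ, ha, hmu, hlam⟩
  obtain ⟨φ, hφ⟩ := hu.exists_energyApprox had
  have hφB := hφ.toW11Approx.mono hball
  refine ⟨_, hφB.memW11_max Metric.isOpen_ball, ?_⟩
  set N := NonuniformElliptic.scaledW11Norm z R (fun x => max (u x) 0)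
    (fun x => (Ioi (0 : ℝ)).indicator (1 : ℝ → ℝ) (u x) • G x) with hN
  have hN0 : 0 ≤ N := NonuniformElliptic.scaledW11Norm_nonneg z hR _ _
  have key : ∀ k : ℕ, ∀ᵐ x ∂(volume.restrict (Metric.ball z (R / 2))),
      u x ≤ 4 * N + 3 * (1 / (k + 1 : ℝ)) := fun k => by
    obtain ⟨ρ, hρ, hfr⟩ := hφB.exists_radius hR (ε := 1 / (k + 1 : ℝ)) (by positivity)
    obtain ⟨s, hs, hsM⟩ := extraction_of_frequently_atTop hfr
    refine ae_restrict_of_ae_restrict_of_subset (Metric.ball_subset_ball hρ.1.le)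
      ((hφ.subseq hs).ae_le_of_sphere had hsub
        ((Metric.closedBall_subset_ball hρ.2).trans hball) (by positivity) hsM)
  filter_upwards [ae_all_iff.2 key] with x hx
  refine ge_of_tendsto' (x := atTop) ?_ hx
  simpa using (tendsto_one_div_add_atTop_nhds_zero_nat.const_mul (3 : ℝ)).const_add (4 * N)
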